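/- **Setting.** Fix a noise level $s>0,\ \gamma>0$ (the values $s_t,\gamma_t$ of the diffusion at a fixed time $t$) and bounds $B_\mu,B_U\ge 0$. There are $K$ latent subspaces; the $k$-th has dimension $d_k$ and carries $n_k$ modes with fixed weights $\pi_{k,l}\ge 0$, $\sum_{l=1}^{n_k}\pi_{k,l}=1$. A parameter is $\theta=(\mu_{k,l},U_{k,l})_{k\le K,\,l\le n_k}$ with $\mu_{k,l},U_{k,l}\in\mathbb R^{d_k}$, i.e. $\theta\in\mathbb R^p$ with $p=2\sum_{k} n_kd_k$, with the Euclidean norm. For $x\in\mathbb R^{d_k}$ put $$w_{k,l}(x)=\pi_{k,l}\,\mathcal N\big(x;\,s\mu_{k,l},\,s^2U_{k,l}U_{k,l}^\top+\gamma^2 I\big),\qquad \delta_{k,l}(x)=\Big(I-\tfrac{s^2}{s^2+\gamma^2}U_{k,l}U_{k,l}^\top\Big)(x-s\mu_{k,l}),$$ $$p_{k,\theta}(x)=\sum_{l=1}^{n_k}w_{k,l}(x),\qquad s_{k,\theta}(x)=-\frac1{\gamma^2}\,\frac{\sum_{l=1}^{n_k}w_{k,l}(x)\,\delta_{k,l}(x)}{p_{k,\theta}(x)}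 .$$ For $x=(x^{(1)},\dots,x^{(K)})\in\prod_k\mathbb R^{d_k}$ (Euclidean norm) the mixture-of-experts score network is $s_\theta(x)=(s_{1,\theta}(x^{(1)}),\dots,s_{K,\theta}(x^{(K)}))$. Let $\Theta\subseteq\{\theta:\|\mu_{k,l}\|\le B_\mu,\ \|U_{k,l}\|\le B_U \text{ for all } k,l\}$ be a parameter set containing the true parameter $\theta^\star$, which satisfies $\|U^\star_{k,l}\|=1$ for all $k,l$. The true score is $s^*(x)=(\nabla\log p_{1,\theta^\star}(x^{(1)}),\dots,\nabla\log p_{K,\theta^\star}(x^{(K)}))$. Let $R>0$, let $\mathcal X$ be a set of points $x$ with $\|x^{(k)}\|\le R$ for all $k$, and let $P$ be a probability measure on $\prod_k\mathbb R^{d_k}$ with $x\in\mathcal X$ for $P$-almost every $x$. For an i.i.d. sample $x_1,\dots,x_n\sim P$, $n\ge1$, let $$\mathcal L(\theta)=\mathbb E_{x\sim P}\|s_\theta(x)-s^*(x)\|^2,\qquad \hat{\mathcal L}_n(\theta)=\frac1n\sum_{i=1}^n\|s_\theta(x_i)-s^*(x_i)\|^2 .$$ Call $L\ge0$ a Lipschitz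 constant of the network if, for every $x\in\mathcal X$, the map $\theta\mapsto s_\theta(x)$ is $L$-Lipschitz on $\Theta$; call $L_\ell\ge0$ a Lipschitz constant of the loss if, for every $x\in\mathcal X$, the map $v\mapsto\|v-s^*(x)\|^2$ is $L_\ell$-Lipschitz on $\{s_\theta(x):\theta\in\Theta\}$. **Theorem.** There are a universal constant $c>0$, a constant $C>0$ that depends only on $s,\gamma,B_\mu,B_U$, and a constant $C_2>0$ that depends only on $s,\gamma,B_\mu,B_U,K,R$, such that in the setting above, with $C_1=c\cdot\operatorname{diam}(\Theta)$: 1. For every $\theta\in\Theta$, $\|s_\theta-s^*\|^2$ is $P$-integrable. Lipschitz constants $L$ of the network and $L_\ell$ of the loss exist, and if $R\ge1$ they can be chosen with $L\,L_\ell\le C\,R^4\sqrt{\sum_k n_k}$. 2. For all Lipschitz constants $L$ of the network and $L_\ell$ of the loss, all $n\ge1$ and all $\delta\in(0,1)$, with probability at least $1-\delta$, $$\sup_{\theta\in\Theta}\big|\hat{\mathcal L}_n(\theta)-\mathcal L(\theta)\big|\ \le\ C_1\,L\,L_\ell\,\sqrt{\frac pn}\;+\;C_2\sqrt{\frac{\log(1/\delta)}{n}}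 .$$ 3. If $R\ge1$, then for all $n\ge1$ and $\delta\in(0,1)$, with probability at least $1-\delta$, $$\sup_{\theta\in\Theta}\big|\hat{\mathcal L}_n(\theta)-\mathcal L(\theta)\big|\ \le\ C\,\frac{R^4\sqrt{\sum_k n_k}\,\sqrt{\sum_k n_kd_k}}{\sqrt n}\;+\;C_2\sqrt{\frac{\log(1/\delta)}{n}} .$$ -/

import Mathlib

open MeasureTheory
open scoped ENNReal NNReal

noncomputable section

namespace MoLRMoG

/-- The latent space `ℝ^d` of one subspace, with its Euclidean norm. -/
abbrev Latent (d : ℕ) : Type := EuclideanSpace ℝ (Fin d)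

/-- The stacked latent coordinates `x = (x⁽¹⁾, …, x⁽ᴷ⁾)`, one block per subspace, with the
Euclidean norm of `ℝ^(d₁ + ⋯ + d_K)`. -/
abbrev Data {K : ℕ} (d : Fin K → ℕ) : Type := PiLp 2 (fun k => Latent (d k))

/-- The parameters `(μ_l, U_l)`, `l = 1, …, m`, of one expert: each `μ_l` and `U_l` is a vector of
`ℝ^d`; Euclidean norm. -/
abbrev ExpertParam (d m : ℕ) : Type := PiLp 2 (fun _ : Fin m => WithLp 2 (Latent d × Latent d))

/-- The parameters `θ = ((μ_{k,l}, U_{k,l})_l)_k` of all experts, with the Euclidean norm of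
`ℝ^p`, `p = 2 ∑ₖ nₖ dₖ`. -/
abbrev Param {K : ℕ} (d n : Fin K → ℕ) : Type := PiLp 2 (fun k => ExpertParam (d k) (n k))

/-- The number of parameters `p = 2 ∑ₖ nₖ dₖ`. -/
def numParams {K : ℕ} (d n : Fin K → ℕ) : ℕ := 2 * ∑ k, n k * d k

/-- `numParams` is the dimension of the parameter space. -/
theorem finrank_param {K : ℕ} (d n : Fin K → ℕ) :
    Module.finrank ℝ (Param d n) = numParams d n := by
  simp only [Param, ExpertParam, Latent, numParams]
  rw [LinearEquiv.finrank_eq (WithLp.linearEquiv 2 ℝ _), Module.finrank_pi_fintype, Finset.mul_sum]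
  refine Finset.sum_congr rfl fun k _ => ?_
  rw [LinearEquiv.finrank_eq (WithLp.linearEquiv 2 ℝ _), Module.finrank_pi_fintype]
  simp only [LinearEquiv.finrank_eq (WithLp.linearEquiv 2 ℝ (Latent (d k) × Latent (d k))),
    Module.finrank_prod, finrank_euclideanSpace_fin]
  simp
  ring

/-- The covariance `s² U Uᵀ + γ² I` of a mode at noise level `(s, γ) = (s_t, γ_t)`. -/
def cov {d : ℕ} (s γ : ℝ) (U : Latent d) : Matrix (Fin d) (Fin d) ℝ :=
  s ^ 2 • Matrix.vecMulVec U U + γ ^ 2 • (1 : Matrix (Fin d) (Fin d) ℝ)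

/-- The density of the Gaussian law `𝒩(m, S)` on `ℝ^d` at the point `x`. -/
def gaussianDensity {d : ℕ} (m : Latent d) (S : Matrix (Fin d) (Fin d) ℝ) (x : Latent d) : ℝ :=
  (2 * Real.pi) ^ (-(d : ℝ) / 2) * S.det ^ (-(1 / 2) : ℝ) *
    Real.exp (-(1 / 2) * dotProduct (x - m) (S⁻¹.mulVec (x - m)))

/-- The weighted mode density `π_l 𝒩(x; s μ_l, s² U_l U_lᵀ + γ² I)`. -/
def modeDensity {d m : ℕ} (s γ : ℝ) (w : Fin m → ℝ) (η : ExpertParam d m) (l : Fin m)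
    (x : Latent d) : ℝ :=
  w l * gaussianDensity (s • (η l).fst) (cov s γ (η l).snd) x

/-- The mixture-of-Gaussians density of one latent subspace at noise level `(s, γ)`. -/
def mixtureDensity {d m : ℕ} (s γ : ℝ) (w : Fin m → ℝ) (η : ExpertParam d m) (x : Latent d) : ℝ :=
  ∑ l, modeDensity s γ w η l x

/-- `δ_l(x) = (I - s² / (s² + γ²) U_l U_lᵀ) (x - s μ_l)`. -/
def residual {d m : ℕ} (s γ : ℝ) (η : ExpertParam d m) (l : Fin m) (x : Latent d) : Latent d :=
  (x - s • (η l).fst) -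
    (s ^ 2 / (s ^ 2 + γ ^ 2) * inner ℝ (η l).snd (x - s • (η l).fst)) • (η l).snd

/-- One expert of the score network: `s_{k,θ}(x) = -(1/γ²) (∑_l w_l(x) δ_l(x)) / ∑_l w_l(x)`. -/
def expertScore {d m : ℕ} (s γ : ℝ) (w : Fin m → ℝ) (η : ExpertParam d m) (x : Latent d) :
    Latent d :=
  (-(1 / γ ^ 2) * (mixtureDensity s γ w η x)⁻¹) •
    ∑ l, modeDensity s γ w η l x • residual s γ η l x

/-- The mixture-of-experts score network `s_θ(x) = (s_{1,θ}(x⁽¹⁾), …, s_{K,θ}(x⁽ᴷ⁾))`. -/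
def scoreNet {K : ℕ} {d n : Fin K → ℕ} (s γ : ℝ) (w : ∀ k, Fin (n k) → ℝ) (θ : Param d n)
    (x : Data d) : Data d :=
  WithLp.toLp 2 fun k => expertScore s γ (w k) (θ k) (x k)

/-- The true score `s*(x) = (∇ log p_{t,1}(x⁽¹⁾), …, ∇ log p_{t,K}(x⁽ᴷ⁾))` of the mixtures with
parameters `θ`. -/
def trueScore {K : ℕ} {d n : Fin K → ℕ} (s γ : ℝ) (w : ∀ k, Fin (n k) → ℝ) (θ : Param d n)
    (x : Data d) : Data d :=
  WithLp.toLp 2 fun k => gradient (fun y => Real.log (mixtureDensity s γ (w k) (θ k) y)) (x k)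

/-- The loss `ℓ(v; x) = ‖v - s*(x)‖²` of a score value `v` at `x`. -/
def scoreLoss {K : ℕ} {d n : Fin K → ℕ} (s γ : ℝ) (w : ∀ k, Fin (n k) → ℝ) (θstar : Param d n)
    (x v : Data d) : ℝ :=
  ‖v - trueScore s γ w θstar x‖ ^ 2

/-- The population loss `𝓛(θ) = 𝔼_{x ∼ P} ‖s_θ(x) - s*(x)‖²`. -/
def popLoss {K : ℕ} {d n : Fin K → ℕ} (s γ : ℝ) (w : ∀ k, Fin (n k) → ℝ) (θstar : Param d n)
    (P : Measure (Data d)) (θ : Param d n) : ℝ :=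
  ∫ x, scoreLoss s γ w θstar x (scoreNet s γ w θ x) ∂P

/-- The empirical loss `(1/N) ∑ᵢ ‖s_θ(xᵢ) - s*(xᵢ)‖²` of a sample `x₁, …, x_N`. -/
def empLoss {K : ℕ} {d n : Fin K → ℕ} (s γ : ℝ) (w : ∀ k, Fin (n k) → ℝ) (θstar : Param d n)
    {N : ℕ} (X : Fin N → Data d) (θ : Param d n) : ℝ :=
  (1 / (N : ℝ)) * ∑ i, scoreLoss s γ w θstar (X i) (scoreNet s γ w θ (X i))

/-- The uniform deviation `sup_{θ ∈ Θ} |𝓛̂_N(θ) - 𝓛(θ)|`, as an extended nonnegative real. -/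
def uniformDeviation {K : ℕ} {d n : Fin K → ℕ} (s γ : ℝ) (w : ∀ k, Fin (n k) → ℝ)
    (θstar : Param d n) (P : Measure (Data d)) (Θ : Set (Param d n)) {N : ℕ}
    (X : Fin N → Data d) : ℝ≥0∞ :=
  ⨆ θ ∈ Θ, ENNReal.ofReal |empLoss s γ w θstar X θ - popLoss s γ w θstar P θ|

/-- `L` is a Lipschitz constant of the score network with respect to `θ ∈ Θ`, uniformly over the
inputs `x` in the data domain `𝒳`. -/
def IsNetLipschitz {K : ℕ} {d n : Fin K → ℕ} (s γ : ℝ) (w : ∀ k, Fin (n k) → ℝ)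
    (𝒳 : Set (Data d)) (Θ : Set (Param d n)) (L : ℝ≥0) : Prop :=
  ∀ x ∈ 𝒳, LipschitzOnWith L (fun θ => scoreNet s γ w θ x) Θ

/-- `Lℓ` is a Lipschitz constant of the loss `v ↦ ‖v - s*(x)‖²` on the values `v = s_θ(x)`,
`θ ∈ Θ`, that the network takes at `x`, uniformly over `x ∈ 𝒳`. -/
def IsLossLipschitz {K : ℕ} {d n : Fin K → ℕ} (s γ : ℝ) (w : ∀ k, Fin (n k) → ℝ)
    (θstar : Param d n) (𝒳 : Set (Data d)) (Θ : Set (Param d n)) (Lℓ : ℝ≥0) : Prop :=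
  ∀ x ∈ 𝒳, LipschitzOnWith Lℓ (scoreLoss s γ w θstar x) ((fun θ => scoreNet s γ w θ x) '' Θ)

end MoLRMoG

end

theorem card_le_of_separated_of_dist_le {E : Type*} [NormedAddCommGroup E] [NormedSpace ℝ E]
    [FiniteDimensional ℝ E] {T : Finset E} {θ₀ : E} {D ε : ℝ} (hε : 0 < ε) (hεD : ε ≤ D)
    (hT : ∀ t ∈ T, dist t θ₀ ≤ D) (hsep : ∀ t ∈ T, ∀ u ∈ T, t ≠ u → ε ≤ dist t u) :
    (T.card : ℝ) ≤ (3 * D / ε) ^ Module.finrank ℝ E := by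
  borelize E
  let μ : Measure E := Measure.addHaar
  have hε2 : 0 < ε / 2 := by positivity
  have hρ : 0 < D + ε / 2 := by linarith
  set A := ⋃ c ∈ T, Metric.ball (c : E) (ε / 2) with hA
  have hdisj : Set.Pairwise (T : Set E) (Function.onFun Disjoint fun c => Metric.ball c (ε / 2)) := by
    rintro c hc d hd hcd
    apply Metric.ball_disjoint_ball
    linarith [hsep c hc d hd hcd]
  have hsub : A ⊆ Metric.ball θ₀ (D + ε / 2) := by
    refine Set.iUnion₂_subset fun x hx => Metric.ball_subset_ball' ?_
    linarith [hT x hx]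
  have I : (T.card : ℝ≥0∞) * ENNReal.ofReal ((ε / 2) ^ Module.finrank ℝ E) * μ (Metric.ball 0 1) ≤
      ENNReal.ofReal ((D + ε / 2) ^ Module.finrank ℝ E) * μ (Metric.ball 0 1) :=
    calc
      _ = μ A := by
        rw [hA, measure_biUnion_finset hdisj fun c _ => measurableSet_ball]
        simp only [μ.addHaar_ball_of_pos _ hε2]
        simp only [Finset.sum_const, nsmul_eq_mul, mul_assoc]
      _ ≤ μ (Metric.ball θ₀ (D + ε / 2)) := measure_mono hsub
      _ = _ := by simp only [μ.addHaar_ball_of_pos _ hρ]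
  have J := (ENNReal.mul_le_mul_iff_left (Metric.measure_ball_pos μ 0 zero_lt_one).ne'
    measure_ball_lt_top.ne).1 I
  have K := ENNReal.toReal_le_of_le_ofReal (pow_nonneg hρ.le _) J
  rw [ENNReal.toReal_mul, ENNReal.toReal_natCast, ENNReal.toReal_ofReal (by positivity),
    ← le_div_iff₀ (by positivity), ← div_pow] at K
  refine K.trans (pow_le_pow_left₀ (by positivity) ?_ _)
  rw [div_le_div_iff₀ hε2 hε]
  nlinarith

theorem exists_finset_cover {E : Type*} [NormedAddCommGroup E] [NormedSpace ℝ E]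
    [FiniteDimensional ℝ E] {Θ : Set E} {θ₀ : E} {D ε : ℝ} (hε : 0 < ε) (hεD : ε ≤ D)
    (hΘ : ∀ θ ∈ Θ, dist θ θ₀ ≤ D) :
    ∃ T : Finset E, (T : Set E) ⊆ Θ ∧ (∀ θ ∈ Θ, ∃ t ∈ T, dist θ t ≤ ε) ∧
      (T.card : ℝ) ≤ (3 * D / ε) ^ Module.finrank ℝ E := by
  classical
  let S : Set ℕ := {m | ∃ T : Finset E, (T : Set E) ⊆ Θ ∧
    (∀ t ∈ T, ∀ u ∈ T, t ≠ u → ε ≤ dist t u) ∧ T.card = m}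
  have hne : S.Nonempty := ⟨0, ∅, by simp⟩
  have hcard : ∀ T : Finset E, (T : Set E) ⊆ Θ → (∀ t ∈ T, ∀ u ∈ T, t ≠ u → ε ≤ dist t u) →
      (T.card : ℝ) ≤ (3 * D / ε) ^ Module.finrank ℝ E := fun T h₁ h₂ =>
    card_le_of_separated_of_dist_le hε hεD (fun t ht => hΘ t (h₁ ht)) h₂
  have hbdd : BddAbove S := by
    refine ⟨⌊(3 * D / ε) ^ Module.finrank ℝ E⌋₊, ?_⟩
    rintro m ⟨T, h₁, h₂, rfl⟩
    exact Nat.le_floor (hcard T h₁ h₂)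
  obtain ⟨T, h₁, h₂, h₃⟩ := Nat.sSup_mem hne hbdd
  refine ⟨T, h₁, fun θ hθ => ?_, hcard T h₁ h₂⟩
  by_contra! hcon
  have hθT : θ ∉ T := fun h => by
    have := hcon θ h
    rw [dist_self] at this
    exact absurd this hε.not_gt
  have : (insert θ T).card ∈ S := by
    refine ⟨insert θ T, ?_, ?_, rfl⟩
    · rw [Finset.coe_insert]
      exact Set.insert_subset hθ h₁
    · intro t ht u hu htu
      rw [Finset.mem_insert] at ht hu
      rcases ht with rfl | ht <;> rcases hu with rfl | hu
      · exact absurd rfl htu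
      · exact (hcon u hu).le
      · rw [dist_comm]; exact (hcon t ht).le
      · exact h₂ t ht u hu htu
  have := le_csSup hbdd this
  rw [Finset.card_insert_of_notMem hθT] at this
  omega

/-- The deviation of the empirical mean of `g` over a sample `X` from its mean under `P`. -/
noncomputable def empDeviation {Ω : Type*} [MeasurableSpace Ω] (P : Measure Ω) {N : ℕ} (g : Ω → ℝ)
    (X : Fin N → Ω) : ℝ :=
  (1 / (N : ℝ)) * ∑ i, g (X i) - ∫ x, g x ∂P

theorem measurable_empDeviation {Ω : Type*} [MeasurableSpace Ω] {P : Measure Ω} {N : ℕ} {g : Ω → ℝ}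
    (hg : Measurable g) : Measurable (empDeviation (N := N) P g) := by
  unfold empDeviation
  fun_prop

theorem empDeviation_sub {Ω : Type*} [MeasurableSpace Ω] {P : Measure Ω} {N : ℕ} {g h : Ω → ℝ}
    (hg : Integrable g P) (hh : Integrable h P) (X : Fin N → Ω) :
    empDeviation P (fun x => g x - h x) X = empDeviation P g X - empDeviation P h X := by
  simp only [empDeviation, Finset.sum_sub_distrib, integral_sub hg hh]
  ring

theorem abs_empDeviation_le {Ω : Type*} [MeasurableSpace Ω] {P : Measure Ω} [IsProbabilityMeasure P]
    {N : ℕ} {g : Ω → ℝ} {σ : ℝ} (hσ : 0 ≤ σ) (hb : ∀ᵐ x ∂P, |g x| ≤ σ) {X : Fin N → Ω}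
    (hX : ∀ i, |g (X i)| ≤ σ) : |empDeviation P g X| ≤ 2 * σ := by
  have h₁ : |∫ x, g x ∂P| ≤ σ := by
    simpa using norm_integral_le_of_norm_le_const (μ := P) (f := g) (C := σ) (by simpa using hb)
  have h₂ : |(1 / (N : ℝ)) * ∑ i, g (X i)| ≤ σ := by
    rw [abs_mul, abs_of_nonneg (by positivity)]
    have : |∑ i, g (X i)| ≤ N * σ := by
      refine (Finset.abs_sum_le_sum_abs _ _).trans ?_
      refine (Finset.sum_le_sum fun i _ => hX i).trans ?_
      simp
    rcases Nat.eq_zero_or_pos N with rfl | hN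
    · simpa using hσ
    · have hN' : (0 : ℝ) < N := by exact_mod_cast hN
      rw [one_div, inv_mul_le_iff₀ hN']
      exact this
  unfold empDeviation
  have := abs_sub ((1 / (N : ℝ)) * ∑ i, g (X i)) (∫ x, g x ∂P)
  linarith

theorem lintegral_exp_abs_empDeviation_le {Ω : Type*} [MeasurableSpace Ω] {P : Measure Ω}
    [IsProbabilityMeasure P] {N : ℕ} (hN : 1 ≤ N) {g : Ω → ℝ} {σ : ℝ}
    (hg : Measurable g) (hb : ∀ᵐ x ∂P, |g x| ≤ σ) (t : ℝ) :
    ∫⁻ X, ENNReal.ofReal (Real.exp (t * |empDeviation P g X|)) ∂(Measure.pi fun _ : Fin N => P) ≤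
      ENNReal.ofReal (2 * Real.exp (t ^ 2 * σ ^ 2 / (2 * N))) := by
  have hN' : (0 : ℝ) < N := by exact_mod_cast hN
  set μ := Measure.pi fun _ : Fin N => P
  have hσ : ProbabilityTheory.HasSubgaussianMGF (fun x => g x - ∫ y, g y ∂P)
      ((‖σ - -σ‖₊ / 2) ^ 2) P :=
    ProbabilityTheory.hasSubgaussianMGF_of_mem_Icc hg.aemeasurable
      (hb.mono fun x hx => abs_le.1 hx)
  have hi : ∀ i : Fin N, ProbabilityTheory.HasSubgaussianMGF
      (fun X : Fin N → Ω => g (X i) - ∫ y, g y ∂P) ((‖σ - -σ‖₊ / 2) ^ 2) μ := fun i => by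
    refine ProbabilityTheory.HasSubgaussianMGF.of_map (Y := fun X : Fin N → Ω => X i)
      (X := fun x => g x - ∫ y, g y ∂P) (measurable_pi_apply i).aemeasurable ?_
    rw [(measurePreserving_eval (fun _ : Fin N => P) i).map_eq]
    exact hσ
  have hind := ProbabilityTheory.iIndepFun_pi (μ := fun _ : Fin N => P)
    (X := fun _ x => g x - ∫ y, g y ∂P) fun _ => (hg.sub_const _).aemeasurable
  have hsum := (ProbabilityTheory.HasSubgaussianMGF.sum_of_iIndepFun hind (s := Finset.univ)
    (fun i _ => hi i)).const_mul (1 / (N : ℝ))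
  have heq : (fun X : Fin N → Ω => (1 / (N : ℝ)) * ∑ i, (g (X i) - ∫ y, g y ∂P)) =
      empDeviation P g := by
    funext X
    simp only [empDeviation, Finset.sum_sub_distrib, Finset.sum_const, Finset.card_univ,
      Fintype.card_fin, nsmul_eq_mul]
    field_simp
  rw [heq] at hsum
  have hbound : ∀ u : ℝ, u ^ 2 = t ^ 2 →
      ∫⁻ X, ENNReal.ofReal (Real.exp (u * empDeviation P g X)) ∂μ ≤
        ENNReal.ofReal (Real.exp (t ^ 2 * σ ^ 2 / (2 * N))) := fun u hu => by
    rw [← ofReal_integral_eq_lintegral_ofReal (hsum.integrable_exp_mul u)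
      (Filter.Eventually.of_forall fun _ => (Real.exp_pos _).le)]
    refine ENNReal.ofReal_le_ofReal ((hsum.mgf_le u).trans_eq ?_)
    have hc : ((∑ _i : Fin N, (‖σ - -σ‖₊ / 2) ^ 2 : ℝ≥0) : ℝ) = N * σ ^ 2 := by
      simp only [Finset.sum_const, Finset.card_univ, Fintype.card_fin, nsmul_eq_mul,
        NNReal.coe_mul, NNReal.coe_natCast, NNReal.coe_pow, NNReal.coe_div, coe_nnnorm,
        NNReal.coe_ofNat, Real.norm_eq_abs, div_pow, sq_abs]
      ring
    change Real.exp ((1 / (N : ℝ)) ^ 2 * ((∑ _i : Fin N, (‖σ - -σ‖₊ / 2) ^ 2 : ℝ≥0) : ℝ) * u ^ 2 / 2)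
      = _
    rw [hc, hu]
    congr 1
    field_simp
  calc ∫⁻ X, ENNReal.ofReal (Real.exp (t * |empDeviation P g X|)) ∂μ
      ≤ ∫⁻ X, (ENNReal.ofReal (Real.exp (t * empDeviation P g X)) +
          ENNReal.ofReal (Real.exp (-t * empDeviation P g X))) ∂μ := by
        refine lintegral_mono fun X => ?_
        rcases abs_cases (empDeviation P g X) with ⟨h, -⟩ | ⟨h, -⟩
        · simp only [h]; exact le_self_add
        · simp only [h, mul_neg, neg_mul]; exact le_add_self
    _ ≤ ENNReal.ofReal (Real.exp (t ^ 2 * σ ^ 2 / (2 * N))) +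
          ENNReal.ofReal (Real.exp (t ^ 2 * σ ^ 2 / (2 * N))) := by
        have hm := measurable_empDeviation (P := P) (N := N) hg
        rw [lintegral_add_left (by fun_prop)]
        exact add_le_add (hbound t rfl) (hbound (-t) (neg_sq t))
    _ = _ := by rw [← ENNReal.ofReal_add (by positivity) (by positivity), ← two_mul]

theorem sum_half_pow_mul_add_le (α : ℝ) (hα : 0 ≤ α) (J : ℕ) :
    ∑ j ∈ Finset.range J, (1 / 2 : ℝ) ^ j * (j + α) ≤ 2 + 2 * α := by
  have h : ∀ J : ℕ, ∑ j ∈ Finset.range J, (1 / 2 : ℝ) ^ j * (j + α) =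
      2 + 2 * α - (1 / 2 : ℝ) ^ J * (2 * J + 2 + 2 * α) := fun J => by
    induction J with
    | zero => simp
    | succ J ih =>
      rw [Finset.sum_range_succ, ih]
      push_cast
      ring
  rw [h]
  have : 0 ≤ (1 / 2 : ℝ) ^ J * (2 * J + 2 + 2 * α) := by positivity
  linarith

/-- The exponent paid for the union over the `j`-th net: `δ⁻¹ 2 ^ (j + 2) (3 2 ^ j q) ^ p` is its
exponential. -/
noncomputable def chainExponent (δ q : ℝ) (p j : ℕ) : ℝ :=
  Real.log (1 / δ) + (j + 2) * Real.log 2 + p * Real.log (3 * 2 ^ j * q)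

theorem exp_neg_chainExponent {δ q : ℝ} (hδ : 0 < δ) (hq : 1 ≤ q) (p j : ℕ) :
    Real.exp (-chainExponent δ q p j) = δ * (1 / 2) ^ (j + 2) * ((3 * 2 ^ j * q) ^ p)⁻¹ := by
  have h3 : 0 < 3 * 2 ^ j * q := by positivity
  rw [chainExponent, one_div, Real.log_inv, ← Real.log_pow,
    show ((j : ℝ) + 2) * Real.log 2 = Real.log (2 ^ (j + 2)) by rw [Real.log_pow]; push_cast; ring,
    neg_add, neg_add, neg_neg, Real.exp_add, Real.exp_add, Real.exp_neg, Real.exp_neg,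
    Real.exp_log hδ, Real.exp_log (by positivity), Real.exp_log (by positivity), one_div, inv_pow]

theorem one_le_chainExponent {δ q : ℝ} (hδ : 0 < δ) (hδ1 : δ < 1) (hq : 1 ≤ q) (p j : ℕ) :
    1 ≤ chainExponent δ q p j := by
  have h₁ : 0 ≤ Real.log (1 / δ) := Real.log_nonneg (by rw [le_div_iff₀ hδ]; linarith)
  have h2j : (1 : ℝ) ≤ 2 ^ j := one_le_pow₀ (by norm_num)
  have h₂ : 0 ≤ Real.log (3 * 2 ^ j * q) := Real.log_nonneg (by nlinarith)
  have h₃ := Real.log_two_gt_d9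
  have h₄ : (0 : ℝ) ≤ j := by positivity
  have h₅ : 0 ≤ p * Real.log (3 * 2 ^ j * q) := by positivity
  unfold chainExponent
  nlinarith

theorem sqrt_chainExponent_le {δ q : ℝ} (hδ : 0 < δ) (hδ1 : δ < 1) (hq : 1 ≤ q) {p : ℕ}
    (hp : 1 ≤ p) (j : ℕ) :
    √(2 * chainExponent δ q p j) ≤ √2 * (√(Real.log (1 / δ)) + √p * (j + (2 + q))) := by
  have hℓ : 0 ≤ Real.log (1 / δ) := Real.log_nonneg (by rw [le_div_iff₀ hδ]; linarith)
  have hp' : (1 : ℝ) ≤ p := by exact_mod_cast hp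
  have hj : (0 : ℝ) ≤ j := by positivity
  rw [Real.sqrt_mul zero_le_two]
  refine mul_le_mul_of_nonneg_left ?_ (Real.sqrt_nonneg _)
  rw [Real.sqrt_le_left (by positivity)]
  have hlog : Real.log (3 * 2 ^ j * q) ≤ 2 + j * Real.log 2 + q := by
    rw [Real.log_mul (by positivity) (by positivity), Real.log_mul (by norm_num) (by positivity),
      Real.log_pow]
    have := Real.log_le_sub_one_of_pos (show (0 : ℝ) < 3 by norm_num)
    have := Real.log_le_sub_one_of_pos (show (0 : ℝ) < q by linarith)
    linarith
  have h2 := Real.log_two_lt_d9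
  have hmain : (j + 2) * Real.log 2 + p * Real.log (3 * 2 ^ j * q) ≤ p * (j + (2 + q)) ^ 2 := by
    have h₁ : ((j : ℝ) + 2) * Real.log 2 ≤ p * (j + 2) := by nlinarith
    have h₂ : (p : ℝ) * Real.log (3 * 2 ^ j * q) ≤ p * (2 + j + q) := by
      refine mul_le_mul_of_nonneg_left (hlog.trans ?_) (by linarith)
      nlinarith
    have h₃ : (p : ℝ) * (j + 2) + p * (2 + j + q) ≤ p * (j + (2 + q)) ^ 2 := by
      rw [← mul_add]
      refine mul_le_mul_of_nonneg_left ?_ (by linarith)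
      nlinarith
    linarith
  have e₁ := Real.sq_sqrt hℓ
  have e₂ := Real.sq_sqrt (show (0 : ℝ) ≤ p by linarith)
  have e₃ : 0 ≤ √(Real.log (1 / δ)) * (√p * (j + (2 + q))) := by positivity
  unfold chainExponent
  calc _ ≤ √(Real.log (1 / δ)) ^ 2 + √p ^ 2 * (j + (2 + q)) ^ 2 := by rw [e₁, e₂]; linarith
    _ ≤ _ := by nlinarith

/-- The chain of links from `θ₀` through nets of `Θ` at the scales `(B / Λ) 2⁻ʲ`. -/
theorem exists_chaining_nets {Ω E : Type*} [MeasurableSpace Ω] [NormedAddCommGroup E]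
    [NormedSpace ℝ E] [FiniteDimensional ℝ E] {P : Measure Ω} {f : E → Ω → ℝ} {Θ : Set E} {θ₀ : E}
    {B Λ r q : ℝ} (hB : 0 < B) (hΛ : 0 < Λ) (hq : 1 ≤ q) (hr : Λ * r = q * B)
    (hΘ : ∀ θ ∈ Θ, dist θ θ₀ ≤ r)
    (hf : ∀ᵐ x ∂P, (∀ θ ∈ Θ, |f θ x| ≤ B) ∧ f θ₀ x = 0 ∧
      ∀ θ ∈ Θ, ∀ θ' ∈ Θ, |f θ x - f θ' x| ≤ Λ * dist θ θ') :
    ∃ (T : ℕ → Finset E) (π : ℕ → E → E), (∀ j, (T j : Set E) ⊆ Θ) ∧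
      (∀ j, ∀ θ ∈ Θ, ∃ t ∈ T j, Λ * dist θ t ≤ B * (1 / 2) ^ j) ∧
      (∀ j, ((T j).card : ℝ) ≤ (3 * 2 ^ j * q) ^ Module.finrank ℝ E) ∧
      (∀ t, π 0 t = θ₀) ∧ (∀ j, ∀ t ∈ T (j + 1), π (j + 1) t ∈ T j) ∧
      ∀ j, ∀ t ∈ T j, ∀ᵐ x ∂P, |f t x - f (π j t) x| ≤ 2 * B * (1 / 2) ^ j := by
  classical
  have hr' : r = q * B / Λ := by rw [← hr]; field_simp
  have hnet := fun j : ℕ => exists_finset_cover (Θ := Θ) (θ₀ := θ₀) (D := r)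
    (ε := B / Λ * (1 / 2) ^ j) (by positivity) (by
      have h1 : (1 / 2 : ℝ) ^ j ≤ 1 := pow_le_one₀ (by norm_num) (by norm_num)
      have h2 : 0 < B / Λ := by positivity
      rw [hr', mul_div_assoc]
      nlinarith) hΘ
  choose T hT₁ hT₂ hT₃ using hnet
  choose! ν hν₁ hν₂ using hT₂
  refine ⟨T, fun j t => if j = 0 then θ₀ else ν (j - 1) t, hT₁, fun j θ hθ =>
    ⟨ν j θ, hν₁ j θ hθ, ?_⟩, fun j => (hT₃ j).trans_eq ?_, fun t => by simp, fun j t ht => ?_,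
    fun j t ht => ?_⟩
  · refine (mul_le_mul_of_nonneg_left (hν₂ j θ hθ) hΛ.le).trans_eq ?_
    field_simp
  · congr 1
    rw [hr', one_div, inv_pow]
    field_simp
  · simpa using hν₁ j t (hT₁ _ ht)
  · rcases j with _ | j
    · filter_upwards [hf] with x ⟨h₁, h₂, _⟩
      simp only [if_true, h₂, sub_zero, pow_zero, mul_one]
      linarith [h₁ t (hT₁ _ ht)]
    · filter_upwards [hf] with x ⟨_, _, h₃⟩
      have htΘ := hT₁ _ ht
      have h := h₃ t htΘ (ν j t) (hT₁ _ (hν₁ j t htΘ))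
      simp only [Nat.add_one_ne_zero, if_false, Nat.add_sub_cancel]
      refine h.trans ((mul_le_mul_of_nonneg_left (hν₂ j t htΘ) hΛ.le).trans_eq ?_)
      rw [pow_succ]
      field_simp

theorem exists_chaining_bound_of_pos {Ω E : Type*} [MeasurableSpace Ω] [NormedAddCommGroup E]
    [NormedSpace ℝ E] [FiniteDimensional ℝ E] {P : Measure Ω} [IsProbabilityMeasure P]
    {f : E → Ω → ℝ} {Θ : Set E} {θ₀ : E} (hθ₀ : θ₀ ∈ Θ) (hp : 1 ≤ Module.finrank ℝ E)
    {B Λ r q : ℝ} (hB : 0 < B) (hΛ : 0 < Λ) (hq : 1 ≤ q) (hr : Λ * r = q * B)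
    (hΘ : ∀ θ ∈ Θ, dist θ θ₀ ≤ r) (hm : ∀ θ ∈ Θ, Measurable (f θ))
    (hf : ∀ᵐ x ∂P, (∀ θ ∈ Θ, |f θ x| ≤ B) ∧ f θ₀ x = 0 ∧
      ∀ θ ∈ Θ, ∀ θ' ∈ Θ, |f θ x - f θ' x| ≤ Λ * dist θ θ')
    {N : ℕ} (hN : 1 ≤ N) {δ : ℝ} (hδ : 0 < δ) (hδ1 : δ < 1) :
    ∃ Q : (Fin N → Ω) → ℝ≥0∞, Measurable Q ∧
      ∫⁻ X, Q X ∂(Measure.pi fun _ => P) ≤ ENNReal.ofReal δ ∧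
      ∀ᵐ X ∂(Measure.pi fun _ : Fin N => P), Q X ≠ ∞ → ∀ θ ∈ Θ,
        √N * |empDeviation P (f θ) X| ≤ 24 * (Λ * r) * √(Module.finrank ℝ E) +
          6 * B * √(Real.log (1 / δ)) + 4 * B * (Q X).toReal := by
  obtain ⟨T, π, hTΘ, hTcov, hTcard, hπ0, hπT, hlink⟩ := exists_chaining_nets hB hΛ hq hr hΘ hf
  set p := Module.finrank ℝ E
  set μ := Measure.pi fun _ : Fin N => P
  have hN' : (0 : ℝ) < N := by exact_mod_cast hN
  have hsN : 0 < √(N : ℝ) := Real.sqrt_pos.2 hN'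
  let a : ℕ → ℝ := chainExponent δ q p
  have ha : ∀ j, 1 ≤ a j := one_le_chainExponent hδ hδ1 hq p
  let σ : ℕ → ℝ := fun j => 2 * B * (1 / 2) ^ j
  have hσ : ∀ j, 0 < σ j := fun j => by positivity
  let u : ℕ → ℝ := fun j => √(2 * a j) * √N / σ j
  have hsa : ∀ j, 1 ≤ √(2 * a j) := fun j => Real.one_le_sqrt.2 (by linarith [ha j])
  have hπΘ : ∀ j, ∀ t ∈ T j, π j t ∈ Θ := by
    rintro (_ | j) t ht
    · rw [hπ0]; exact hθ₀
    · exact hTΘ j (hπT j t ht)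
  let g : ℕ → E → Ω → ℝ := fun j t x => f t x - f (π j t) x
  have hg : ∀ j, ∀ t ∈ T j, Measurable (g j t) := fun j t ht =>
    (hm t (hTΘ j ht)).sub (hm _ (hπΘ j t ht))
  have hint : ∀ θ ∈ Θ, Integrable (f θ) P := fun θ hθ =>
    Integrable.of_bound (hm θ hθ).aestronglyMeasurable B (hf.mono fun x hx => hx.1 θ hθ)
  let F : ℕ → E → (Fin N → Ω) → ℝ≥0∞ := fun j t X =>
    ENNReal.ofReal (Real.exp (u j * |empDeviation P (g j t) X|)) *
      ENNReal.ofReal (Real.exp (-(2 * a j)))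
  have hFm : ∀ j, ∀ t ∈ T j, Measurable (F j t) := fun j t ht => by
    have := measurable_empDeviation (P := P) (N := N) (hg j t ht)
    fun_prop
  refine ⟨fun X => ∑' j, ∑ t ∈ T j, F j t X,
    Measurable.tsum fun j => Finset.measurable_fun_sum _ fun t ht => hFm j t ht, ?_, ?_⟩
  · have hF : ∀ j, ∀ t ∈ T j, ∫⁻ X, F j t X ∂μ ≤ ENNReal.ofReal (2 * Real.exp (-a j)) := by
      intro j t ht
      have hgm := measurable_empDeviation (P := P) (N := N) (hg j t ht)
      rw [lintegral_mul_const _ (by fun_prop)]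
      refine (mul_le_mul_left (lintegral_exp_abs_empDeviation_le hN (hg j t ht)
        (hlink j t ht) (u j)) _).trans_eq ?_
      rw [← ENNReal.ofReal_mul (by positivity), mul_assoc, ← Real.exp_add]
      congr 3
      have h₁ : u j ^ 2 * (2 * B * (1 / 2) ^ j) ^ 2 / (2 * N) = a j := by
        change (√(2 * a j) * √N / σ j) ^ 2 * (σ j) ^ 2 / (2 * N) = a j
        have := hσ j
        rw [div_pow, mul_pow, Real.sq_sqrt (by linarith [ha j]), Real.sq_sqrt hN'.le]
        field_simp
      rw [h₁]
      ring
    rw [lintegral_tsum fun j => (Finset.measurable_fun_sum _ fun t ht => hFm j t ht).aemeasurable]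
    have hj : ∀ j, ∫⁻ X, ∑ t ∈ T j, F j t X ∂μ ≤ ENNReal.ofReal (δ * (1 / 2) ^ (j + 1)) := by
      intro j
      rw [lintegral_finsetSum' _ fun t ht => (hFm j t ht).aemeasurable]
      refine (Finset.sum_le_sum fun t ht => hF j t ht).trans ?_
      rw [Finset.sum_const, nsmul_eq_mul, ← ENNReal.ofReal_natCast,
        ← ENNReal.ofReal_mul (by positivity)]
      refine ENNReal.ofReal_le_ofReal ?_
      rw [show Real.exp (-a j) = _ from exp_neg_chainExponent hδ hq p j]
      have hpos : 0 < (3 * 2 ^ j * q) ^ p := by positivity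
      calc ((T j).card : ℝ) * (2 * (δ * (1 / 2) ^ (j + 2) * ((3 * 2 ^ j * q) ^ p)⁻¹))
          ≤ (3 * 2 ^ j * q) ^ p * (2 * (δ * (1 / 2) ^ (j + 2) * ((3 * 2 ^ j * q) ^ p)⁻¹)) :=
            mul_le_mul_of_nonneg_right (hTcard j) (by positivity)
        _ = δ * (1 / 2) ^ (j + 1) := by
            rw [pow_succ (1 / 2 : ℝ) (j + 1)]
            generalize (3 * 2 ^ j * q) ^ p = z at hpos
            field_simp
    refine (ENNReal.tsum_le_tsum hj).trans_eq ?_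
    have hs : HasSum (fun j : ℕ => δ * (1 / 2 : ℝ) ^ (j + 1)) δ := by
      have h := hasSum_geometric_two.mul_left (δ / 2)
      rw [div_mul_cancel₀ δ two_ne_zero] at h
      have e : (fun j : ℕ => δ * (1 / 2 : ℝ) ^ (j + 1)) = fun j => δ / 2 * (1 / 2) ^ j := by
        funext j
        rw [pow_succ]
        ring
      rwa [e]
    rw [← ENNReal.ofReal_tsum_of_nonneg (fun j => by positivity) hs.summable, hs.tsum_eq]
  · have hall : ∀ᵐ X ∂μ, ∀ i, (∀ θ ∈ Θ, |f θ (X i)| ≤ B) ∧ f θ₀ (X i) = 0 ∧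
        ∀ θ ∈ Θ, ∀ θ' ∈ Θ, |f θ (X i) - f θ' (X i)| ≤ Λ * dist θ θ' := by
      rw [ae_all_iff]
      exact fun i => (Measure.quasiMeasurePreserving_eval (fun _ : Fin N => P) i).ae hf
    filter_upwards [hall] with X hX hQ θ hθ
    set Q := ∑' j, ∑ t ∈ T j, F j t X
    have hlinkX : ∀ j, ∀ t ∈ T j, √N * |empDeviation P (g j t) X| ≤
        σ j * (√(2 * a j) + Q.toReal) := by
      intro j t ht
      have hle : F j t X ≤ Q :=
        (Finset.single_le_sum (f := fun t => F j t X) (fun _ _ => zero_le) ht).trans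
          (ENNReal.le_tsum j)
      have h₁ := ENNReal.toReal_mono hQ hle
      simp only [F] at h₁
      rw [← ENNReal.ofReal_mul (Real.exp_pos _).le, ← Real.exp_add,
        ENNReal.toReal_ofReal (Real.exp_pos _).le] at h₁
      have h₂ := Real.add_one_le_exp (u j * |empDeviation P (g j t) X| + -(2 * a j))
      have h₃ : u j * |empDeviation P (g j t) X| ≤ 2 * a j + Q.toReal := by linarith
      have hsq := Real.mul_self_sqrt (show 0 ≤ 2 * a j by linarith [ha j])
      have hQ0 : 0 ≤ Q.toReal := ENNReal.toReal_nonneg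
      have h₄ : √(2 * a j) * (√N * |empDeviation P (g j t) X|) ≤
          √(2 * a j) * (σ j * (√(2 * a j) + Q.toReal)) := by
        have e : √(2 * a j) * (√N * |empDeviation P (g j t) X|) =
            σ j * (u j * |empDeviation P (g j t) X|) := by
          simp only [u]
          have := hσ j
          field_simp
        rw [e, mul_left_comm (√(2 * a j))]
        refine mul_le_mul_of_nonneg_left (h₃.trans ?_) (hσ j).le
        rw [mul_add, hsq]
        nlinarith [hsa j]
      exact le_of_mul_le_mul_left h₄ (by linarith [hsa j])
    have hθ₀dev : empDeviation P (f θ₀) X = 0 := by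
      have h₁ : ∫ x, f θ₀ x ∂P = 0 := integral_eq_zero_of_ae (hf.mono fun x hx => hx.2.1)
      simp [empDeviation, h₁, fun i => (hX i).2.1]
    have hchain : ∀ j, ∀ t ∈ T j, √N * |empDeviation P (f t) X| ≤
        ∑ i ∈ Finset.range (j + 1), σ i * (√(2 * a i) + Q.toReal) := by
      intro j
      induction j with
      | zero =>
        intro t ht
        have h := hlinkX 0 t ht
        have e := empDeviation_sub (hint t (hTΘ 0 ht)) (hint _ (hπΘ 0 t ht)) X
        simp only [g] at h
        rw [e, hπ0, hθ₀dev, sub_zero] at h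
        simpa using h
      | succ j ih =>
        intro t ht
        have h := hlinkX (j + 1) t ht
        have e := empDeviation_sub (hint t (hTΘ _ ht)) (hint _ (hπΘ _ t ht)) X
        simp only [g] at h
        rw [e] at h
        have h' := ih _ (hπT j t ht)
        rw [Finset.sum_range_succ]
        have h3 := abs_sub_abs_le_abs_sub (empDeviation P (f t) X)
          (empDeviation P (f (π (j + 1) t)) X)
        nlinarith
    have hsum : ∀ j, ∑ i ∈ Finset.range (j + 1), σ i * (√(2 * a i) + Q.toReal) ≤
        24 * (Λ * r) * √p + 6 * B * √(Real.log (1 / δ)) + 4 * B * Q.toReal := by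
      intro j
      have hterm : ∀ i, σ i * (√(2 * a i) + Q.toReal) ≤
          2 * B * (√2 * √(Real.log (1 / δ)) + Q.toReal) * (1 / 2) ^ i +
          2 * B * √2 * √p * ((1 / 2) ^ i * (i + (2 + q))) := by
        intro i
        have := sqrt_chainExponent_le hδ hδ1 hq hp i
        calc σ i * (√(2 * a i) + Q.toReal) ≤
            σ i * (√2 * (√(Real.log (1 / δ)) + √p * (i + (2 + q))) + Q.toReal) :=
              mul_le_mul_of_nonneg_left (by linarith) (hσ i).le
          _ = _ := by simp only [σ]; ring
      refine (Finset.sum_le_sum fun i _ => hterm i).trans ?_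
      rw [Finset.sum_add_distrib, ← Finset.mul_sum, ← Finset.mul_sum]
      have g₁ : ∑ i ∈ Finset.range (j + 1), (1 / 2 : ℝ) ^ i ≤ 2 := sum_geometric_two_le _
      have g₂ := sum_half_pow_mul_add_le (2 + q) (by linarith) (j + 1)
      have hQ0 : 0 ≤ Q.toReal := ENNReal.toReal_nonneg
      have hs2 : √2 ≤ 3 / 2 := by
        rw [Real.sqrt_le_left (by norm_num)]; norm_num
      have k₁ := mul_le_mul_of_nonneg_left g₁
        (show 0 ≤ 2 * B * (√2 * √(Real.log (1 / δ)) + Q.toReal) by positivity)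
      have k₂ := mul_le_mul_of_nonneg_left g₂ (show 0 ≤ 2 * B * √2 * √p by positivity)
      have k₃ : 2 * B * √2 * √p * (2 + 2 * (2 + q)) ≤ 24 * (Λ * r) * √p := by
        rw [hr]
        have : 2 * B * √2 * (2 + 2 * (2 + q)) ≤ 2 * B * (3 / 2) * (8 * q) := by
          refine mul_le_mul (mul_le_mul_of_nonneg_left hs2 (by positivity)) (by linarith)
            (by linarith) (by positivity)
        have hsp : 0 ≤ √(p : ℝ) := Real.sqrt_nonneg _
        nlinarith
      have k₄ : B * (√2 * √(Real.log (1 / δ))) ≤ B * (3 / 2 * √(Real.log (1 / δ))) := by gcongr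
      nlinarith
    refine le_of_forall_pos_le_add fun ε hε => ?_
    obtain ⟨j, hj⟩ := exists_pow_lt_of_lt_one (show 0 < ε / (√N * (2 * B)) by positivity)
      (show (1 / 2 : ℝ) < 1 by norm_num)
    rw [lt_div_iff₀ (by positivity)] at hj
    obtain ⟨t, ht, htd⟩ := hTcov j θ hθ
    have htΘ := hTΘ j ht
    have hclose : |empDeviation P (f θ) X - empDeviation P (f t) X| ≤ 2 * (B * (1 / 2) ^ j) := by
      rw [← empDeviation_sub (hint θ hθ) (hint t htΘ)]
      exact abs_empDeviation_le (by positivity)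
        (hf.mono fun x hx => (hx.2.2 θ hθ t htΘ).trans htd)
        fun i => ((hX i).2.2 θ hθ t htΘ).trans htd
    have h₁ := (hchain j t ht).trans (hsum j)
    have h₂ := abs_sub_abs_le_abs_sub (empDeviation P (f θ) X) (empDeviation P (f t) X)
    have h₃ : √N * |empDeviation P (f θ) X| ≤
        √N * |empDeviation P (f t) X| + √N * (2 * (B * (1 / 2) ^ j)) := by
      rw [← mul_add]
      exact mul_le_mul_of_nonneg_left (by linarith) hsN.le
    nlinarith

/-- A chaining bound for the uniform deviation of empirical means of a family of functions that is
bounded, Lipschitz in a finite-dimensional parameter and vanishes at one parameter. -/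
theorem exists_chaining_bound {Ω E : Type*} [MeasurableSpace Ω] [NormedAddCommGroup E]
    [NormedSpace ℝ E] [FiniteDimensional ℝ E] {P : Measure Ω} [IsProbabilityMeasure P]
    {f : E → Ω → ℝ} {Θ : Set E} {θ₀ : E} (hθ₀ : θ₀ ∈ Θ) {B Λ r : ℝ} (hB : 0 ≤ B) (hΛ : 0 ≤ Λ)
    (hΘ : ∀ θ ∈ Θ, dist θ θ₀ ≤ r) (hm : ∀ θ ∈ Θ, Measurable (f θ))
    (hf : ∀ᵐ x ∂P, (∀ θ ∈ Θ, |f θ x| ≤ B) ∧ f θ₀ x = 0 ∧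
      ∀ θ ∈ Θ, ∀ θ' ∈ Θ, |f θ x - f θ' x| ≤ Λ * dist θ θ')
    {N : ℕ} (hN : 1 ≤ N) {δ : ℝ} (hδ : 0 < δ) (hδ1 : δ < 1) :
    ∃ Q : (Fin N → Ω) → ℝ≥0∞, Measurable Q ∧
      ∫⁻ X, Q X ∂(Measure.pi fun _ => P) ≤ ENNReal.ofReal (δ * √(Module.finrank ℝ E)) ∧
      ∀ᵐ X ∂(Measure.pi fun _ : Fin N => P), Q X ≠ ∞ → ∀ θ ∈ Θ,
        √N * |empDeviation P (f θ) X| ≤ 24 * (Λ * r) * √(Module.finrank ℝ E) +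
          6 * B * √(Real.log (1 / δ)) + 4 * (Λ * r) * (Q X).toReal := by
  have hr0 : 0 ≤ r := dist_nonneg.trans (hΘ θ₀ hθ₀)
  by_cases hzero : ∀ᵐ x ∂P, ∀ θ ∈ Θ, f θ x = 0
  · refine ⟨0, measurable_const, by simp, ?_⟩
    have hall : ∀ᵐ X ∂(Measure.pi fun _ : Fin N => P), ∀ i, ∀ θ ∈ Θ, f θ (X i) = 0 := by
      rw [ae_all_iff]
      exact fun i => (Measure.quasiMeasurePreserving_eval (fun _ : Fin N => P) i).ae hzero
    filter_upwards [hall] with X hX _ θ hθ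
    have h₁ : ∫ x, f θ x ∂P = 0 := integral_eq_zero_of_ae (hzero.mono fun x hx => hx θ hθ)
    have h₂ : empDeviation P (f θ) X = 0 := by simp [empDeviation, h₁, fun i => hX i θ hθ]
    rw [h₂]
    simp only [abs_zero, mul_zero]
    have := ENNReal.toReal_nonneg (a := (0 : (Fin N → Ω) → ℝ≥0∞) X)
    positivity
  · have hD : ∀ᵐ x ∂P, ∀ θ ∈ Θ, |f θ x| ≤ Λ * r := hf.mono fun x hx θ hθ => by
      have := hx.2.2 θ hθ θ₀ hθ₀
      rw [hx.2.1, sub_zero] at this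
      exact this.trans (mul_le_mul_of_nonneg_left (hΘ θ hθ) hΛ)
    have hB0 : 0 < B := by
      refine hB.lt_of_ne fun h => hzero (hf.mono fun x hx θ hθ => ?_)
      have := hx.1 θ hθ
      rwa [← h, abs_nonpos_iff] at this
    have hD0 : 0 < Λ * r := by
      refine (mul_nonneg hΛ hr0).lt_of_ne fun h => hzero (hD.mono fun x hx θ hθ => ?_)
      have := hx θ hθ
      rwa [← h, abs_nonpos_iff] at this
    have hΛ0 : 0 < Λ := hΛ.lt_of_ne fun h => by simp [← h] at hD0
    have hp : 1 ≤ Module.finrank ℝ E := by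
      by_contra hp
      have hp0 : Module.finrank ℝ E = 0 := by omega
      have : Subsingleton E := Module.finrank_zero_iff.1 hp0
      exact hzero (hf.mono fun x hx θ _ => by rw [Subsingleton.elim θ θ₀, hx.2.1])
    have hm0 : 0 < min B (Λ * r) := lt_min hB0 hD0
    obtain ⟨Q, hQ₁, hQ₂, hQ₃⟩ := exists_chaining_bound_of_pos (q := Λ * r / min B (Λ * r)) hθ₀ hp
      hm0 hΛ0 (by rw [le_div_iff₀ hm0, one_mul]; exact min_le_right _ _)
      (by field_simp) hΘ hm
      (by
        filter_upwards [hf, hD] with x hx hx'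
        exact ⟨fun θ hθ => le_min (hx.1 θ hθ) (hx' θ hθ), hx.2⟩) hN hδ hδ1
    refine ⟨Q, hQ₁, hQ₂.trans (ENNReal.ofReal_le_ofReal ?_), ?_⟩
    · have : 1 ≤ √(Module.finrank ℝ E : ℝ) := Real.one_le_sqrt.2 (by exact_mod_cast hp)
      nlinarith
    · filter_upwards [hQ₃] with X hX hQ θ hθ
      refine (hX hQ θ hθ).trans ?_
      have h₁ := min_le_left B (Λ * r)
      have h₂ := min_le_right B (Λ * r)
      gcongr

namespace MoLRMoG

theorem dotProduct_ofLp_eq_inner {d : ℕ} (u v : Latent d) :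
    dotProduct (WithLp.ofLp u) (WithLp.ofLp v) = inner ℝ u v := by
  rw [EuclideanSpace.inner_eq_star_dotProduct, dotProduct_comm]
  rfl

theorem det_cov {d : ℕ} {s γ : ℝ} (hγ : 0 < γ) (U : Latent d) :
    (cov s γ U).det = (γ ^ 2) ^ d * (γ ^ 2)⁻¹ * (γ ^ 2 + s ^ 2 * ‖U‖ ^ 2) := by
  have h : cov s γ U = γ ^ 2 • (1 + Matrix.replicateCol Unit ((s ^ 2 / γ ^ 2) • WithLp.ofLp U) *
      Matrix.replicateRow Unit (WithLp.ofLp U)) := by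
    rw [← Matrix.vecMulVec_eq, Matrix.smul_vecMulVec, smul_add, smul_smul, cov, add_comm]
    congr 2
    field_simp
  rw [h, Matrix.det_smul, Fintype.card_fin, Matrix.det_one_add_replicateCol_mul_replicateRow,
    dotProduct_smul, dotProduct_ofLp_eq_inner, real_inner_self_eq_norm_sq, smul_eq_mul]
  field_simp

theorem inv_cov_mulVec {d : ℕ} {s γ : ℝ} (hγ : 0 < γ) (U v : Latent d) :
    (cov s γ U)⁻¹.mulVec (WithLp.ofLp v) = WithLp.ofLp ((γ ^ 2)⁻¹ •
      (v - (s ^ 2 / (γ ^ 2 + s ^ 2 * ‖U‖ ^ 2) * inner ℝ U v) • U)) := by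
  have hA : 0 < γ ^ 2 + s ^ 2 * ‖U‖ ^ 2 := by positivity
  have hdet : IsUnit (cov s γ U).det := by
    rw [det_cov hγ]
    exact (by positivity : (0 : ℝ) < _).ne'.isUnit
  have h : (cov s γ U).mulVec (WithLp.ofLp ((γ ^ 2)⁻¹ •
      (v - (s ^ 2 / (γ ^ 2 + s ^ 2 * ‖U‖ ^ 2) * inner ℝ U v) • U))) = WithLp.ofLp v := by
    simp only [cov, Matrix.add_mulVec, Matrix.smul_mulVec, Matrix.one_mulVec,
      Matrix.vecMulVec_mulVec, dotProduct_ofLp_eq_inner, inner_smul_right, inner_sub_right,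
      real_inner_self_eq_norm_sq]
    funext i
    simp only [WithLp.ofLp_smul, WithLp.ofLp_sub, Pi.add_apply, Pi.smul_apply, Pi.sub_apply,
      smul_eq_mul, MulOpposite.smul_eq_mul_unop, MulOpposite.unop_op]
    field_simp
    ring
  rw [← h, Matrix.mulVec_mulVec, Matrix.nonsing_inv_mul _ hdet, Matrix.one_mulVec]

/-- The logarithm of a mode density, up to an additive constant that depends on `γ` and `d` only. -/
noncomputable def logMode {d : ℕ} (s γ : ℝ) (μ U x : Latent d) : ℝ :=
  -(1 / 2) * Real.log (γ ^ 2 + s ^ 2 * ‖U‖ ^ 2) - 1 / (2 * γ ^ 2) * (‖x - s • μ‖ ^ 2 -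
    s ^ 2 * (inner ℝ U (x - s • μ)) ^ 2 / (γ ^ 2 + s ^ 2 * ‖U‖ ^ 2))

theorem exists_gaussianDensity_eq {γ : ℝ} (hγ : 0 < γ) (d : ℕ) (s : ℝ) :
    ∃ c : ℝ, 0 < c ∧ ∀ μ U x : Latent d,
      gaussianDensity (s • μ) (cov s γ U) x = c * Real.exp (logMode s γ μ U x) := by
  refine ⟨(2 * Real.pi) ^ (-(d : ℝ) / 2) * ((γ ^ 2) ^ d * (γ ^ 2)⁻¹) ^ (-(1 / 2) : ℝ),
    by positivity, fun μ U x => ?_⟩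
  have hA : 0 < γ ^ 2 + s ^ 2 * ‖U‖ ^ 2 := by positivity
  have hsub : WithLp.ofLp x - WithLp.ofLp (s • μ) = WithLp.ofLp (x - s • μ) := rfl
  rw [gaussianDensity, det_cov hγ, Real.mul_rpow (by positivity) hA.le, hsub,
    inv_cov_mulVec hγ, dotProduct_ofLp_eq_inner, Real.rpow_def_of_pos hA, ← mul_assoc, mul_assoc _
    (Real.exp _) (Real.exp _), ← Real.exp_add, logMode, inner_smul_right, inner_sub_right,
    real_inner_self_eq_norm_sq, inner_smul_right, real_inner_comm U]
  congr 2
  field_simp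
  ring

/-- The posterior weights `w_l exp a_l / ∑ w_j exp a_j`. -/
noncomputable def softWeight {m : ℕ} (w a : Fin m → ℝ) (l : Fin m) : ℝ :=
  w l * Real.exp (a l) / ∑ j, w j * Real.exp (a j)

section softWeight

variable {m : ℕ} {w a b : Fin m → ℝ}

theorem sum_mul_exp_pos (hw : ∀ l, 0 ≤ w l) (hw1 : ∑ l, w l = 1) :
    0 < ∑ j, w j * Real.exp (a j) := by
  obtain ⟨i, -, hi⟩ := Finset.exists_ne_zero_of_sum_ne_zero (s := Finset.univ) (f := w)
    (by rw [hw1]; exact one_ne_zero)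
  exact Finset.sum_pos' (fun j _ => mul_nonneg (hw j) (Real.exp_pos _).le)
    ⟨i, Finset.mem_univ i, mul_pos ((hw i).lt_of_ne' hi) (Real.exp_pos _)⟩

theorem softWeight_nonneg (hw : ∀ l, 0 ≤ w l) (l : Fin m) : 0 ≤ softWeight w a l :=
  div_nonneg (mul_nonneg (hw l) (Real.exp_pos _).le)
    (Finset.sum_nonneg fun j _ => mul_nonneg (hw j) (Real.exp_pos _).le)

theorem sum_softWeight (hw : ∀ l, 0 ≤ w l) (hw1 : ∑ l, w l = 1) : ∑ l, softWeight w a l = 1 := by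
  simp only [softWeight]
  rw [← Finset.sum_div, div_self (sum_mul_exp_pos hw hw1).ne']

theorem softWeight_sub_le (hw : ∀ l, 0 ≤ w l) (hw1 : ∑ l, w l = 1) {ε : ℝ}
    (hab : ∀ l, |a l - b l| ≤ ε) (l : Fin m) :
    softWeight w a l - softWeight w b l ≤ 2 * ε * softWeight w a l := by
  have hA := sum_mul_exp_pos (a := a) hw hw1
  have hB := sum_mul_exp_pos (a := b) hw hw1
  have hnum : Real.exp (-ε) * (w l * Real.exp (a l)) ≤ w l * Real.exp (b l) := by
    rw [mul_left_comm, ← Real.exp_add]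
    refine mul_le_mul_of_nonneg_left (Real.exp_le_exp.2 ?_) (hw l)
    linarith [(abs_le.1 (hab l)).2]
  have hden : Real.exp (-ε) * ∑ j, w j * Real.exp (b j) ≤ ∑ j, w j * Real.exp (a j) := by
    rw [Finset.mul_sum]
    refine Finset.sum_le_sum fun j _ => ?_
    rw [mul_left_comm, ← Real.exp_add]
    refine mul_le_mul_of_nonneg_left (Real.exp_le_exp.2 ?_) (hw j)
    linarith [(abs_le.1 (hab j)).1]
  have h : Real.exp (-ε) * Real.exp (-ε) * softWeight w a l ≤ softWeight w b l := by
    unfold softWeight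
    rw [← mul_div_assoc, div_le_div_iff₀ hA hB]
    have := mul_le_mul hnum hden (by positivity) (mul_nonneg (hw l) (Real.exp_pos _).le)
    linarith
  have hexp : 1 - 2 * ε ≤ Real.exp (-ε) * Real.exp (-ε) := by
    rw [← Real.exp_add]
    linarith [Real.add_one_le_exp (-ε + -ε)]
  have := mul_le_mul_of_nonneg_right hexp (softWeight_nonneg (a := a) hw l)
  linarith

theorem sum_abs_softWeight_sub_le (hw : ∀ l, 0 ≤ w l) (hw1 : ∑ l, w l = 1) {ε : ℝ}
    (hab : ∀ l, |a l - b l| ≤ ε) : ∑ l, |softWeight w a l - softWeight w b l| ≤ 4 * ε := by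
  have h : ∀ l, |softWeight w a l - softWeight w b l| ≤
      2 * ε * (softWeight w a l + softWeight w b l) := fun l => by
    have hε : 0 ≤ ε := (abs_nonneg _).trans (hab l)
    have h₁ := softWeight_sub_le hw hw1 hab l
    have h₂ := softWeight_sub_le hw hw1
      (fun l => by rw [abs_sub_comm]; exact hab l : ∀ l, |b l - a l| ≤ ε) l
    have h₃ := mul_nonneg hε (softWeight_nonneg (a := a) hw l)
    have h₄ := mul_nonneg hε (softWeight_nonneg (a := b) hw l)
    rw [abs_le]
    constructor <;> linarith
  refine (Finset.sum_le_sum fun l _ => h l).trans_eq ?_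
  rw [← Finset.mul_sum, Finset.sum_add_distrib, sum_softWeight hw hw1, sum_softWeight hw hw1]
  ring

end softWeight

theorem exists_modeDensity_eq {γ : ℝ} (hγ : 0 < γ) (d : ℕ) (s : ℝ) :
    ∃ c : ℝ, 0 < c ∧ ∀ {m : ℕ} (w : Fin m → ℝ) (η : ExpertParam d m) (l : Fin m) (x : Latent d),
      modeDensity s γ w η l x = c * (w l * Real.exp (logMode s γ (η l).fst (η l).snd x)) := by
  obtain ⟨c, hc, h⟩ := exists_gaussianDensity_eq hγ d s
  refine ⟨c, hc, fun w η l x => ?_⟩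
  rw [modeDensity, h]
  ring

section expert

variable {d m : ℕ} {s γ : ℝ} {w : Fin m → ℝ}

theorem expertScore_eq (hγ : 0 < γ) (η : ExpertParam d m) (x : Latent d) :
    expertScore s γ w η x = -(1 / γ ^ 2) • ∑ l,
      softWeight w (fun l => logMode s γ (η l).fst (η l).snd x) l • residual s γ η l x := by
  obtain ⟨c, hc, h⟩ := exists_modeDensity_eq hγ d s
  simp only [expertScore, mixtureDensity, h, softWeight, mul_smul]
  rw [← Finset.mul_sum, ← Finset.smul_sum]
  congr 1
  rw [mul_inv, smul_smul, mul_right_comm, inv_mul_cancel₀ hc.ne', one_mul, Finset.smul_sum]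
  refine Finset.sum_congr rfl fun l _ => ?_
  rw [smul_smul, smul_smul]
  congr 1
  rw [div_eq_inv_mul, mul_assoc]

theorem continuous_logMode (μ U : Latent d) : Continuous (logMode s γ μ U) := by
  unfold logMode
  fun_prop

theorem continuous_expertScore (hγ : 0 < γ) (hw : ∀ l, 0 ≤ w l) (hw1 : ∑ l, w l = 1)
    (η : ExpertParam d m) : Continuous (expertScore s γ w η) := by
  simp only [funext (expertScore_eq (s := s) (w := w) hγ η), softWeight, residual]
  have hl : ∀ l, Continuous fun x => logMode s γ (η l).fst (η l).snd x := fun l =>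
    continuous_logMode _ _
  refine Continuous.fun_const_smul (continuous_finsetSum _ fun l _ =>
    Continuous.fun_smul ?_ (by fun_prop)) _
  exact Continuous.div (by fun_prop) (by fun_prop) fun x => (sum_mul_exp_pos hw hw1).ne'

theorem hasFDerivAt_logMode (μ U x : Latent d) (hU : ‖U‖ = 1) (hγ : 0 < γ) :
    HasFDerivAt (logMode s γ μ U) (innerSL ℝ (-(1 / γ ^ 2) • ((x - s • μ) -
      (s ^ 2 / (s ^ 2 + γ ^ 2) * inner ℝ U (x - s • μ)) • U))) x := by
  have h₁ : HasFDerivAt (fun y : Latent d => y - s • μ) (ContinuousLinearMap.id ℝ _) x :=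
    (hasFDerivAt_id x).sub_const _
  have h₂ := h₁.norm_sq
  have h₃ := ((innerSL ℝ U).hasFDerivAt.comp x h₁).pow 2
  have h := ((h₂.sub ((h₃.const_mul (s ^ 2)).mul_const (γ ^ 2 + s ^ 2 * ‖U‖ ^ 2)⁻¹)).const_mul
    (1 / (2 * γ ^ 2))).const_sub (-(1 / 2) * Real.log (γ ^ 2 + s ^ 2 * ‖U‖ ^ 2))
  refine HasFDerivAt.congr_fderiv (h.congr_of_eventuallyEq ?_) ?_
  · exact Filter.Eventually.of_forall fun y => by simp [logMode, div_eq_mul_inv]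
  · ext v
    simp [hU]
    field_simp
    ring

theorem gradient_log_mixtureDensity (hγ : 0 < γ) (hw : ∀ l, 0 ≤ w l) (hw1 : ∑ l, w l = 1)
    (η : ExpertParam d m) (hη : ∀ l, ‖(η l).snd‖ = 1) (x : Latent d) :
    gradient (fun y => Real.log (mixtureDensity s γ w η y)) x = expertScore s γ w η x := by
  obtain ⟨c, hc, h⟩ := exists_modeDensity_eq hγ d s
  refine HasGradientAt.gradient ?_
  rw [hasGradientAt_iff_hasFDerivAt, expertScore_eq hγ]
  simp only [mixtureDensity, h]
  have h₁ : HasFDerivAt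
      (fun y => ∑ l, c * (w l * Real.exp (logMode s γ (η l).fst (η l).snd y))) _ x :=
    HasFDerivAt.fun_sum fun l _ =>
      (((hasFDerivAt_logMode (s := s) (η l).fst (η l).snd x (hη l) hγ).exp).const_mul (w l)).const_mul c
  have hpos := sum_mul_exp_pos (a := fun l => logMode s γ (η l).fst (η l).snd x) hw hw1
  have h₂ := h₁.log (by rw [← Finset.mul_sum]; positivity)
  refine h₂.congr_fderiv ?_
  ext v
  rw [← Finset.mul_sum]
  simp only [softWeight, residual, InnerProductSpace.toDual_apply_apply, inner_smul_left,
    sum_inner, smul_apply, sum_apply, innerSL_apply_apply,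
    smul_eq_mul, Finset.mul_sum, conj_trivial]
  refine Finset.sum_congr rfl fun l _ => ?_
  rw [← Finset.mul_sum]
  generalize inner ℝ _ v = z
  field_simp

end expert

section perturbation

variable {d : ℕ} {s γ Bμ BU ρ h : ℝ} {μ μ' U U' x : Latent d}

theorem norm_sub_smul_le (hs : 0 < s) (hBμ : 0 ≤ Bμ) (hρ : 1 ≤ ρ) (hx : ‖x‖ ≤ ρ) (hμ : ‖μ‖ ≤ Bμ) :
    ‖x - s • μ‖ ≤ (1 + s * Bμ) * ρ := by
  have h₁ := norm_sub_le x (s • μ)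
  rw [norm_smul, Real.norm_of_nonneg hs.le] at h₁
  have h₂ : s * ‖μ‖ ≤ s * Bμ * ρ :=
    (mul_le_mul_of_nonneg_left hμ hs.le).trans (le_mul_of_one_le_right (by positivity) hρ)
  linarith

theorem norm_sub_smul_sub_le (hs : 0 < s) (hμ : ‖μ - μ'‖ ≤ h) :
    ‖(x - s • μ) - (x - s • μ')‖ ≤ s * h := by
  rw [sub_sub_sub_cancel_left, ← smul_sub, norm_smul, Real.norm_of_nonneg hs.le, norm_sub_rev]
  exact mul_le_mul_of_nonneg_left hμ hs.le

theorem abs_inner_le {y : Latent d} {Y : ℝ} (hBU : 0 ≤ BU) (hU : ‖U‖ ≤ BU) (hy : ‖y‖ ≤ Y) :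
    |inner ℝ U y| ≤ BU * Y :=
  (abs_real_inner_le_norm U y).trans (mul_le_mul hU hy (norm_nonneg _) hBU)

theorem abs_inner_sub_inner_le {y y' : Latent d} {Y e : ℝ} (hBU : 0 ≤ BU) (hU' : ‖U'‖ ≤ BU)
    (hy : ‖y‖ ≤ Y) (hUU : ‖U - U'‖ ≤ h) (hyy : ‖y - y'‖ ≤ e) :
    |inner ℝ U y - inner ℝ U' y'| ≤ h * Y + BU * e := by
  have e₁ : inner ℝ U y - inner ℝ U' y' = inner ℝ (U - U') y + inner ℝ U' (y - y') := by
    rw [inner_sub_left, inner_sub_right]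
    ring
  rw [e₁]
  exact (abs_add_le _ _).trans (add_le_add
    (abs_inner_le ((norm_nonneg _).trans hUU) hUU hy) (abs_inner_le hBU hU' hyy))

theorem abs_log_sub_log_le {A A' a : ℝ} (ha : 0 < a) (hA : a ≤ A) (hA' : a ≤ A') :
    |Real.log A - Real.log A'| ≤ |A - A'| / a := by
  have h : ∀ A A' : ℝ, a ≤ A → a ≤ A' → Real.log A - Real.log A' ≤ |A - A'| / a := by
    intro A A' hA hA'
    have h0 : 0 < A := ha.trans_le hA
    have h0' : 0 < A' := ha.trans_le hA'
    rw [← Real.log_div h0.ne' h0'.ne']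
    refine (Real.log_le_sub_one_of_pos (by positivity)).trans ?_
    rw [div_sub_one h0'.ne']
    calc (A - A') / A' ≤ |A - A'| / A' := by gcongr; exact le_abs_self _
      _ ≤ _ := by gcongr
  rw [abs_le]
  have h₁ := h A A' hA hA'
  have h₂ := h A' A hA' hA
  rw [abs_sub_comm A' A] at h₂
  constructor <;> linarith

theorem abs_sq_sub_sq_le {a b c e : ℝ} (ha : |a| ≤ c) (hb : |b| ≤ c) (hab : |a - b| ≤ e) :
    |a ^ 2 - b ^ 2| ≤ 2 * c * e := by
  rw [sq_sub_sq, abs_mul]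
  refine mul_le_mul ?_ hab (abs_nonneg _) (by linarith [abs_nonneg a])
  linarith [abs_add_le a b]

theorem abs_div_sub_div_le {u u' A A' a c e g : ℝ} (ha : 0 < a) (hA : a ≤ A) (hA' : a ≤ A')
    (hu' : |u'| ≤ c) (huu : |u - u'| ≤ e) (hAA : |A - A'| ≤ g) :
    |u / A - u' / A'| ≤ e / a + c * g / a ^ 2 := by
  have h0 : 0 < A := ha.trans_le hA
  have h0' : 0 < A' := ha.trans_le hA'
  have e₁ : u / A - u' / A' = (u - u') / A + u' * (A' - A) / (A * A') := by
    field_simp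
    ring
  rw [e₁]
  refine (abs_add_le _ _).trans (add_le_add ?_ ?_)
  · rw [abs_div, abs_of_pos h0]
    exact div_le_div₀ ((abs_nonneg _).trans huu) huu ha hA
  · rw [abs_div, abs_mul, abs_of_pos (mul_pos h0 h0'), abs_sub_comm]
    refine div_le_div₀ (mul_nonneg ((abs_nonneg _).trans hu') ((abs_nonneg _).trans hAA))
      (mul_le_mul hu' hAA (abs_nonneg _) ((abs_nonneg _).trans hu')) (by positivity) ?_
    rw [sq]
    exact mul_le_mul hA hA' ha.le h0.le

end perturbation

/-- The log density of a mode is Lipschitz in its parameters, with a constant that is quadratic in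
the size of the data. -/
theorem exists_logMode_lipschitz {s γ Bμ BU : ℝ} (hs : 0 < s) (hγ : 0 < γ) (hBμ : 0 ≤ Bμ)
    (hBU : 0 ≤ BU) : ∃ M : ℝ, 0 ≤ M ∧ ∀ {d : ℕ} {ρ h : ℝ} {μ μ' U U' x : Latent d}, 1 ≤ ρ →
      ‖x‖ ≤ ρ → ‖μ‖ ≤ Bμ → ‖μ'‖ ≤ Bμ → ‖U‖ ≤ BU → ‖U'‖ ≤ BU → ‖μ - μ'‖ ≤ h → ‖U - U'‖ ≤ h →
      |logMode s γ μ U x - logMode s γ μ' U' x| ≤ M * ρ ^ 2 * h := by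
  set y₀ := 1 + s * Bμ with hy₀
  have hy₀1 : 0 ≤ y₀ := by positivity
  refine ⟨s ^ 2 * BU / γ ^ 2 + 1 / (2 * γ ^ 2) * (2 * y₀ * s + s ^ 2 *
    (2 * BU * y₀ * (y₀ + BU * s) / γ ^ 2 + BU ^ 2 * y₀ ^ 2 * (2 * s ^ 2 * BU) / (γ ^ 2) ^ 2)),
    by positivity, ?_⟩
  intro d ρ h μ μ' U U' x hρ hx hμ hμ' hU hU' hμμ hUU
  have hh : 0 ≤ h := (norm_nonneg _).trans hμμ
  have hy : ‖x - s • μ‖ ≤ y₀ * ρ := norm_sub_smul_le hs hBμ hρ hx hμ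
  have hy' : ‖x - s • μ'‖ ≤ y₀ * ρ := norm_sub_smul_le hs hBμ hρ hx hμ'
  have hyy : ‖(x - s • μ) - (x - s • μ')‖ ≤ s * h := norm_sub_smul_sub_le hs hμμ
  unfold logMode
  set y := x - s • μ
  set y' := x - s • μ'
  have hA : ∀ V : Latent d, γ ^ 2 ≤ γ ^ 2 + s ^ 2 * ‖V‖ ^ 2 := fun V => by
    have : 0 ≤ s ^ 2 * ‖V‖ ^ 2 := by positivity
    linarith
  have hAA : |(γ ^ 2 + s ^ 2 * ‖U‖ ^ 2) - (γ ^ 2 + s ^ 2 * ‖U'‖ ^ 2)| ≤ 2 * s ^ 2 * BU * h := by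
    rw [add_sub_add_left_eq_sub, ← mul_sub, abs_mul, abs_of_nonneg (sq_nonneg s)]
    have := abs_sq_sub_sq_le (c := BU) (e := h) (by rwa [abs_norm]) (by rwa [abs_norm])
      ((abs_norm_sub_norm_le U U').trans hUU)
    exact (mul_le_mul_of_nonneg_left this (sq_nonneg s)).trans_eq (by ring)
  have hγ2 : 0 < γ ^ 2 := by positivity
  have hlog := (abs_log_sub_log_le hγ2 (hA U) (hA U')).trans
    (div_le_div_of_nonneg_right hAA hγ2.le)
  have hnorm := abs_sq_sub_sq_le (a := ‖y‖) (b := ‖y'‖) (c := y₀ * ρ) (e := s * h)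
    (by rwa [abs_norm]) (by rwa [abs_norm]) ((abs_norm_sub_norm_le y y').trans hyy)
  have hb := abs_inner_le hBU hU hy
  have hb' := abs_inner_le hBU hU' hy'
  have hbb := abs_inner_sub_inner_le hBU hU' hy hUU hyy
  have hsq := abs_sq_sub_sq_le hb hb' hbb
  have hb2 : |(inner ℝ U' y' : ℝ) ^ 2| ≤ (BU * (y₀ * ρ)) ^ 2 := by
    rw [abs_pow]
    exact pow_le_pow_left₀ (abs_nonneg _) hb' 2
  have hdiv := abs_div_sub_div_le hγ2 (hA U) (hA U') hb2 hsq hAA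
  set A := γ ^ 2 + s ^ 2 * ‖U‖ ^ 2
  set A' := γ ^ 2 + s ^ 2 * ‖U'‖ ^ 2
  have e₁ : -(1 / 2) * Real.log A - 1 / (2 * γ ^ 2) * (‖y‖ ^ 2 - s ^ 2 * inner ℝ U y ^ 2 / A) -
      (-(1 / 2) * Real.log A' - 1 / (2 * γ ^ 2) * (‖y'‖ ^ 2 - s ^ 2 * inner ℝ U' y' ^ 2 / A')) =
      -(1 / 2) * (Real.log A - Real.log A') + -(1 / (2 * γ ^ 2)) * ((‖y‖ ^ 2 - ‖y'‖ ^ 2) +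
        -s ^ 2 * (inner ℝ U y ^ 2 / A - inner ℝ U' y' ^ 2 / A')) := by ring
  rw [e₁]
  have hρ2 : ρ ≤ ρ ^ 2 := le_self_pow₀ hρ two_ne_zero
  have hρ1 : 1 ≤ ρ ^ 2 := one_le_pow₀ hρ
  have t₁ : |-(1 / 2) * (Real.log A - Real.log A')| ≤ s ^ 2 * BU / γ ^ 2 * ρ ^ 2 * h := by
    rw [abs_mul, abs_neg, abs_of_pos (by norm_num : (0 : ℝ) < 1 / 2)]
    calc 1 / 2 * |Real.log A - Real.log A'| ≤ 1 / 2 * (2 * s ^ 2 * BU * h / γ ^ 2) := by gcongr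
      _ = s ^ 2 * BU / γ ^ 2 * 1 * h := by ring
      _ ≤ _ := by gcongr
  have t₂ : |‖y‖ ^ 2 - ‖y'‖ ^ 2| ≤ 2 * y₀ * s * ρ ^ 2 * h := by
    calc _ ≤ 2 * (y₀ * ρ) * (s * h) := hnorm
      _ = 2 * y₀ * s * ρ * h := by ring
      _ ≤ _ := by gcongr
  have t₃ : |inner ℝ U y ^ 2 / A - inner ℝ U' y' ^ 2 / A'| ≤
      (2 * BU * y₀ * (y₀ + BU * s) / γ ^ 2 +
        BU ^ 2 * y₀ ^ 2 * (2 * s ^ 2 * BU) / (γ ^ 2) ^ 2) * ρ ^ 2 * h := by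
    refine hdiv.trans ?_
    have g₁ : h * (y₀ * ρ) + BU * (s * h) ≤ (y₀ + BU * s) * ρ * h := by
      have : BU * (s * h) * 1 ≤ BU * (s * h) * ρ := by gcongr
      linear_combination this
    calc _ ≤ 2 * (BU * (y₀ * ρ)) * ((y₀ + BU * s) * ρ * h) / γ ^ 2 +
          (BU * (y₀ * ρ)) ^ 2 * (2 * s ^ 2 * BU * h) / (γ ^ 2) ^ 2 := by gcongr
      _ = _ := by ring
  have t₄ : |(‖y‖ ^ 2 - ‖y'‖ ^ 2) + -s ^ 2 * (inner ℝ U y ^ 2 / A - inner ℝ U' y' ^ 2 / A')| ≤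
      2 * y₀ * s * ρ ^ 2 * h + s ^ 2 * ((2 * BU * y₀ * (y₀ + BU * s) / γ ^ 2 +
        BU ^ 2 * y₀ ^ 2 * (2 * s ^ 2 * BU) / (γ ^ 2) ^ 2) * ρ ^ 2 * h) := by
    refine (abs_add_le _ _).trans (add_le_add t₂ ?_)
    rw [abs_mul, abs_neg, abs_of_nonneg (sq_nonneg s)]
    gcongr
  refine (abs_add_le _ _).trans ((add_le_add t₁ ?_).trans_eq (b := s ^ 2 * BU / γ ^ 2 * ρ ^ 2 * h +
    1 / (2 * γ ^ 2) * (2 * y₀ * s * ρ ^ 2 * h + s ^ 2 * ((2 * BU * y₀ * (y₀ + BU * s) / γ ^ 2 +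
        BU ^ 2 * y₀ ^ 2 * (2 * s ^ 2 * BU) / (γ ^ 2) ^ 2) * ρ ^ 2 * h)) ) (by ring))
  rw [abs_mul, abs_neg, abs_of_pos (by positivity : (0 : ℝ) < 1 / (2 * γ ^ 2))]
  gcongr

section residual

variable {d m : ℕ} {s γ Bμ BU ρ h : ℝ} {η η' : ExpertParam d m} {x : Latent d}

theorem sq_div_sq_add_sq_le_one (s γ : ℝ) : s ^ 2 / (s ^ 2 + γ ^ 2) ≤ 1 :=
  div_le_one_of_le₀ (by linarith [sq_nonneg γ]) (by positivity)

theorem norm_residual_le (hs : 0 < s) (hBμ : 0 ≤ Bμ) (hBU : 0 ≤ BU) (hρ : 1 ≤ ρ) (hx : ‖x‖ ≤ ρ)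
    {l : Fin m} (hη : ‖(η l).fst‖ ≤ Bμ ∧ ‖(η l).snd‖ ≤ BU) :
    ‖residual s γ η l x‖ ≤ (1 + s * Bμ) * (1 + BU ^ 2) * ρ := by
  have hy := norm_sub_smul_le hs hBμ hρ hx hη.1
  have hb := abs_inner_le hBU hη.2 hy
  have hκ := sq_div_sq_add_sq_le_one s γ
  have hκ0 : 0 ≤ s ^ 2 / (s ^ 2 + γ ^ 2) := by positivity
  unfold residual
  refine (norm_sub_le _ _).trans ?_
  rw [norm_smul, Real.norm_eq_abs, abs_mul, abs_of_nonneg hκ0]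
  calc _ ≤ (1 + s * Bμ) * ρ + (1 * (BU * ((1 + s * Bμ) * ρ))) * BU := by
        refine add_le_add hy (mul_le_mul (mul_le_mul hκ hb (abs_nonneg _) zero_le_one) hη.2
          (norm_nonneg _) (by positivity))
    _ = _ := by ring

theorem norm_residual_sub_le (hs : 0 < s) (hBμ : 0 ≤ Bμ) (hBU : 0 ≤ BU) (hρ : 1 ≤ ρ)
    (hx : ‖x‖ ≤ ρ) {l : Fin m} (hη : ‖(η l).fst‖ ≤ Bμ ∧ ‖(η l).snd‖ ≤ BU)
    (hη' : ‖(η' l).fst‖ ≤ Bμ ∧ ‖(η' l).snd‖ ≤ BU)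
    (hh : ‖(η l).fst - (η' l).fst‖ ≤ h ∧ ‖(η l).snd - (η' l).snd‖ ≤ h) :
    ‖residual s γ η l x - residual s γ η' l x‖ ≤
      (s + 2 * (1 + s * Bμ) * BU + BU ^ 2 * s) * ρ * h := by
  have hy := norm_sub_smul_le hs hBμ hρ hx hη.1
  have hy' := norm_sub_smul_le hs hBμ hρ hx hη'.1
  have hyy := norm_sub_smul_sub_le (x := x) hs hh.1
  have hb := abs_inner_le hBU hη.2 hy
  have hbb := abs_inner_sub_inner_le hBU hη'.2 hy hh.2 hyy
  have hκ := sq_div_sq_add_sq_le_one s γ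
  have hκ0 : 0 ≤ s ^ 2 / (s ^ 2 + γ ^ 2) := by positivity
  have hh0 : 0 ≤ h := (norm_nonneg _).trans hh.1
  unfold residual
  set y := x - s • (η l).fst
  set y' := x - s • (η' l).fst
  set κ := s ^ 2 / (s ^ 2 + γ ^ 2)
  have e : (y - (κ * inner ℝ (η l).snd y) • (η l).snd) -
      (y' - (κ * inner ℝ (η' l).snd y') • (η' l).snd) = (y - y') -
      κ • ((inner ℝ (η l).snd y) • ((η l).snd - (η' l).snd) +
        (inner ℝ (η l).snd y - inner ℝ (η' l).snd y') • (η' l).snd) := by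
    module
  rw [e]
  refine (norm_sub_le _ _).trans ?_
  rw [norm_smul, Real.norm_of_nonneg hκ0]
  have h₁ : ‖(inner ℝ (η l).snd y) • ((η l).snd - (η' l).snd) +
        (inner ℝ (η l).snd y - inner ℝ (η' l).snd y') • (η' l).snd‖ ≤
      BU * ((1 + s * Bμ) * ρ) * h + (h * ((1 + s * Bμ) * ρ) + BU * (s * h)) * BU := by
    refine (norm_add_le _ _).trans (add_le_add ?_ ?_) <;> rw [norm_smul, Real.norm_eq_abs]
    · exact mul_le_mul hb hh.2 (norm_nonneg _) (by positivity)
    · exact mul_le_mul hbb hη'.2 (norm_nonneg _) (by positivity)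
  calc _ ≤ s * h + 1 * (BU * ((1 + s * Bμ) * ρ) * h +
        (h * ((1 + s * Bμ) * ρ) + BU * (s * h)) * BU) := by
        refine add_le_add hyy (mul_le_mul hκ h₁ (norm_nonneg _) zero_le_one)
    _ = 2 * (1 + s * Bμ) * BU * ρ * h + (s + BU ^ 2 * s) * 1 * h := by ring
    _ ≤ 2 * (1 + s * Bμ) * BU * ρ * h + (s + BU ^ 2 * s) * ρ * h := by gcongr
    _ = _ := by ring

end residual

/-- One expert is bounded linearly in the size `ρ` of the data, and Lipschitz in its parameters, with
respect to the maximum over the modes, with a constant that is cubic in `ρ`. -/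
theorem exists_expertScore_bounds {s γ Bμ BU : ℝ} (hs : 0 < s) (hγ : 0 < γ) (hBμ : 0 ≤ Bμ)
    (hBU : 0 ≤ BU) : ∃ M : ℝ, 0 < M ∧ ∀ {d m : ℕ} {w : Fin m → ℝ}, (∀ l, 0 ≤ w l) → ∑ l, w l = 1 →
      ∀ {ρ : ℝ} {x : Latent d}, 1 ≤ ρ → ‖x‖ ≤ ρ → ∀ {η : ExpertParam d m},
      (∀ l, ‖(η l).fst‖ ≤ Bμ ∧ ‖(η l).snd‖ ≤ BU) →
      ‖expertScore s γ w η x‖ ≤ M * ρ ∧ ∀ {η' : ExpertParam d m} {h : ℝ},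
      (∀ l, ‖(η' l).fst‖ ≤ Bμ ∧ ‖(η' l).snd‖ ≤ BU) →
      (∀ l, ‖(η l).fst - (η' l).fst‖ ≤ h ∧ ‖(η l).snd - (η' l).snd‖ ≤ h) →
      ‖expertScore s γ w η x - expertScore s γ w η' x‖ ≤ M * ρ ^ 3 * h := by
  obtain ⟨Ma, hMa, hlog⟩ := exists_logMode_lipschitz hs hγ hBμ hBU
  set C₀ := (1 + s * Bμ) * (1 + BU ^ 2)
  set C₁ := s + 2 * (1 + s * Bμ) * BU + BU ^ 2 * s
  have hC₀ : 0 < C₀ := by positivity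
  have hC₁ : 0 < C₁ := by positivity
  refine ⟨1 / γ ^ 2 * (C₀ + C₁ + 4 * Ma * C₀), by positivity, ?_⟩
  intro d m w hw hw1 ρ x hρ hx η hη
  constructor
  · rw [expertScore_eq hγ, norm_smul, norm_neg, Real.norm_of_nonneg (by positivity), mul_assoc]
    refine mul_le_mul_of_nonneg_left ?_ (by positivity)
    calc _ ≤ ∑ l, softWeight w (fun l => logMode s γ (η l).fst (η l).snd x) l * (C₀ * ρ) := by
          refine norm_sum_le_of_le _ fun l _ => ?_
          rw [norm_smul, Real.norm_of_nonneg (softWeight_nonneg hw l)]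
          exact mul_le_mul_of_nonneg_left (norm_residual_le hs hBμ hBU hρ hx (hη l))
            (softWeight_nonneg hw l)
      _ = C₀ * ρ := by rw [← Finset.sum_mul, sum_softWeight hw hw1, one_mul]
      _ ≤ _ := by
          refine mul_le_mul_of_nonneg_right ?_ (by linarith)
          have : 0 ≤ 4 * Ma * C₀ := by positivity
          linarith
  · intro η' h hη' hh
    have hm : m ≠ 0 := by
      rintro rfl
      simp at hw1
    have hh0 : 0 ≤ h := (norm_nonneg _).trans (hh ⟨0, Nat.pos_of_ne_zero hm⟩).1
    set a := fun l => logMode s γ (η l).fst (η l).snd x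
    set a' := fun l => logMode s γ (η' l).fst (η' l).snd x
    have haa : ∀ l, |a l - a' l| ≤ Ma * ρ ^ 2 * h := fun l =>
      hlog hρ hx (hη l).1 (hη' l).1 (hη l).2 (hη' l).2 (hh l).1 (hh l).2
    have hsoft := sum_abs_softWeight_sub_le hw hw1 haa
    rw [expertScore_eq hγ, expertScore_eq hγ, ← smul_sub, norm_smul, norm_neg,
      Real.norm_of_nonneg (by positivity), mul_assoc, mul_assoc]
    refine mul_le_mul_of_nonneg_left ?_ (by positivity)
    have e : ∑ l, softWeight w a l • residual s γ η l x -
        ∑ l, softWeight w a' l • residual s γ η' l x =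
        ∑ l, softWeight w a l • (residual s γ η l x - residual s γ η' l x) +
        ∑ l, (softWeight w a l - softWeight w a' l) • residual s γ η' l x := by
      rw [← Finset.sum_sub_distrib, ← Finset.sum_add_distrib]
      exact Finset.sum_congr rfl fun l _ => by module
    rw [e]
    have h₁ : ‖∑ l, softWeight w a l • (residual s γ η l x - residual s γ η' l x)‖ ≤
        C₁ * ρ * h := by
      calc _ ≤ ∑ l, softWeight w a l * (C₁ * ρ * h) := by
            refine norm_sum_le_of_le _ fun l _ => ?_
            rw [norm_smul, Real.norm_of_nonneg (softWeight_nonneg hw l)]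
            exact mul_le_mul_of_nonneg_left
              (norm_residual_sub_le hs hBμ hBU hρ hx (hη l) (hη' l) (hh l))
              (softWeight_nonneg hw l)
        _ = _ := by rw [← Finset.sum_mul, sum_softWeight hw hw1, one_mul]
    have h₂ : ‖∑ l, (softWeight w a l - softWeight w a' l) • residual s γ η' l x‖ ≤
        4 * (Ma * ρ ^ 2 * h) * (C₀ * ρ) := by
      calc _ ≤ ∑ l, |softWeight w a l - softWeight w a' l| * (C₀ * ρ) := by
            refine norm_sum_le_of_le _ fun l _ => ?_
            rw [norm_smul, Real.norm_eq_abs]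
            exact mul_le_mul_of_nonneg_left (norm_residual_le hs hBμ hBU hρ hx (hη' l))
              (abs_nonneg _)
        _ ≤ _ := by
            rw [← Finset.sum_mul]
            exact mul_le_mul_of_nonneg_right hsoft (by positivity)
    have hρ3 : ρ ≤ ρ ^ 3 := le_self_pow₀ hρ (by norm_num)
    calc _ ≤ C₁ * ρ * h + 4 * (Ma * ρ ^ 2 * h) * (C₀ * ρ) := (norm_add_le _ _).trans (add_le_add h₁ h₂)
      _ = C₁ * ρ * h + 4 * Ma * C₀ * (ρ ^ 3 * h) := by ring
      _ ≤ C₁ * ρ ^ 3 * h + 4 * Ma * C₀ * (ρ ^ 3 * h) + C₀ * (ρ ^ 3 * h) := by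
          have : 0 ≤ C₀ * (ρ ^ 3 * h) := by positivity
          have : C₁ * ρ * h ≤ C₁ * ρ ^ 3 * h := by gcongr
          linarith
      _ = _ := by ring

end MoLRMoG

/-- Markov's inequality, in the form of a lower bound for the probability of an event that contains
almost all of a sublevel set. -/
theorem ofReal_one_sub_le_measure_of_lintegral_le {Ω : Type*} [MeasurableSpace Ω] {μ : Measure Ω}
    [IsProbabilityMeasure μ] {Q : Ω → ℝ≥0∞} (hQ : Measurable Q) {δ a : ℝ} (hδ : 0 < δ)
    (ha : 0 ≤ a) (hint : ∫⁻ X, Q X ∂μ ≤ ENNReal.ofReal (δ * a)) {S : Set Ω}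
    (hS : ∀ᵐ X ∂μ, Q X ≤ ENNReal.ofReal a → X ∈ S) : ENNReal.ofReal (1 - δ) ≤ μ S := by
  set A := {X | Q X ≤ ENNReal.ofReal a}
  have hA : MeasurableSet A := measurableSet_le hQ measurable_const
  have hcompl : μ Aᶜ ≤ ENNReal.ofReal δ := by
    rcases ha.eq_or_lt with rfl | ha
    · have h0 : ∫⁻ X, Q X ∂μ = 0 := by simpa using hint
      rw [lintegral_eq_zero_iff hQ] at h0
      have : μ Aᶜ = 0 := ae_iff.1
        (h0.mono fun X hX => by simp [hX] : ∀ᵐ X ∂μ, Q X ≤ ENNReal.ofReal 0)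
      rw [this]
      exact zero_le
    · calc μ Aᶜ ≤ μ {X | ENNReal.ofReal a ≤ Q X} :=
            measure_mono fun X (hX : ¬Q X ≤ ENNReal.ofReal a) => (not_le.1 hX).le
        _ ≤ (∫⁻ X, Q X ∂μ) / ENNReal.ofReal a :=
            meas_ge_le_lintegral_div hQ.aemeasurable (by simpa using ha) ENNReal.ofReal_ne_top
        _ ≤ ENNReal.ofReal (δ * a) / ENNReal.ofReal a := by gcongr
        _ = ENNReal.ofReal δ := by
            rw [← ENNReal.ofReal_div_of_pos ha, mul_div_assoc, div_self ha.ne', mul_one]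
  calc ENNReal.ofReal (1 - δ) = 1 - ENNReal.ofReal δ := by
        rw [ENNReal.ofReal_sub _ hδ.le, ENNReal.ofReal_one]
    _ ≤ 1 - μ Aᶜ := tsub_le_tsub_left hcompl 1
    _ = μ A := by rw [← prob_compl_eq_one_sub hA.compl, compl_compl]
    _ ≤ μ S := measure_mono_ae (hS.mono fun X hX h => hX h)

namespace MoLRMoG

theorem norm_fst_le_norm {d : ℕ} (z : WithLp 2 (Latent d × Latent d)) : ‖z.fst‖ ≤ ‖z‖ := by
  rw [← sq_le_sq₀ (norm_nonneg _) (norm_nonneg _), WithLp.prod_norm_sq_eq_of_L2]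
  linarith [sq_nonneg ‖z.snd‖]

theorem norm_snd_le_norm {d : ℕ} (z : WithLp 2 (Latent d × Latent d)) : ‖z.snd‖ ≤ ‖z‖ := by
  rw [← sq_le_sq₀ (norm_nonneg _) (norm_nonneg _), WithLp.prod_norm_sq_eq_of_L2]
  linarith [sq_nonneg ‖z.fst‖]

theorem norm_le_norm_fst_add_norm_snd {d : ℕ} (z : WithLp 2 (Latent d × Latent d)) :
    ‖z‖ ≤ ‖z.fst‖ + ‖z.snd‖ := by
  rw [← sq_le_sq₀ (norm_nonneg _) (by positivity), WithLp.prod_norm_sq_eq_of_L2]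
  linarith [mul_nonneg (norm_nonneg z.fst) (norm_nonneg z.snd),
    add_sq ‖z.fst‖ ‖z.snd‖]

theorem piLp_norm_le_sum_norm {ι : Type*} [Fintype ι] {E : ι → Type*}
    [∀ i, SeminormedAddCommGroup (E i)] (z : PiLp 2 E) : ‖z‖ ≤ ∑ i, ‖z i‖ := by
  rw [← sq_le_sq₀ (norm_nonneg _) (Finset.sum_nonneg fun i _ => norm_nonneg _),
    PiLp.norm_sq_eq_of_L2]
  exact Finset.sum_sq_le_sq_sum_of_nonneg fun i _ => norm_nonneg _

theorem isBounded_of_norm_le {K : ℕ} {d n : Fin K → ℕ} {Bμ BU : ℝ} {Θ : Set (Param d n)}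
    (hΘ : ∀ θ ∈ Θ, ∀ k l, ‖(θ k l).fst‖ ≤ Bμ ∧ ‖(θ k l).snd‖ ≤ BU) : Bornology.IsBounded Θ := by
  refine isBounded_iff_forall_norm_le.2 ⟨∑ k, ∑ _l : Fin (n k), (Bμ + BU), fun θ hθ => ?_⟩
  refine (piLp_norm_le_sum_norm θ).trans (Finset.sum_le_sum fun k _ => ?_)
  refine (piLp_norm_le_sum_norm (θ k)).trans (Finset.sum_le_sum fun l _ => ?_)
  exact (norm_le_norm_fst_add_norm_snd _).trans (add_le_add (hΘ θ hθ k l).1 (hΘ θ hθ k l).2)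

/-- The squared error of one expert with respect to the expert with parameters `η₀`. -/
noncomputable def expertLoss {d m : ℕ} (s γ : ℝ) (w : Fin m → ℝ) (η₀ η : ExpertParam d m)
    (x : Latent d) : ℝ :=
  ‖expertScore s γ w η x - expertScore s γ w η₀ x‖ ^ 2

section scoreNet

variable {K : ℕ} {d n : Fin K → ℕ} {s γ : ℝ} {w : ∀ k, Fin (n k) → ℝ} {θstar : Param d n}

theorem trueScore_eq_scoreNet (hγ : 0 < γ) (hw : ∀ k l, 0 ≤ w k l) (hw1 : ∀ k, ∑ l, w k l = 1)
    (hU : ∀ k l, ‖(θstar k l).snd‖ = 1) (x : Data d) :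
    trueScore s γ w θstar x = scoreNet s γ w θstar x := by
  unfold trueScore scoreNet
  congr 1
  funext k
  exact gradient_log_mixtureDensity hγ (hw k) (hw1 k) (θstar k) (hU k) (x k)

theorem scoreLoss_scoreNet_eq_sum (hγ : 0 < γ) (hw : ∀ k l, 0 ≤ w k l)
    (hw1 : ∀ k, ∑ l, w k l = 1) (hU : ∀ k l, ‖(θstar k l).snd‖ = 1) (θ : Param d n) (x : Data d) :
    scoreLoss s γ w θstar x (scoreNet s γ w θ x) =
      ∑ k, expertLoss s γ (w k) (θstar k) (θ k) (x k) := by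
  rw [scoreLoss, trueScore_eq_scoreNet hγ hw hw1 hU, PiLp.norm_sq_eq_of_L2]
  rfl

theorem measurable_expertLoss (hγ : 0 < γ) (hw : ∀ k l, 0 ≤ w k l) (hw1 : ∀ k, ∑ l, w k l = 1)
    (k : Fin K) (η₀ η : ExpertParam (d k) (n k)) :
    Measurable fun x : Data d => expertLoss s γ (w k) η₀ η (x k) := by
  have h := fun η => continuous_expertScore (s := s) (d := d k) hγ (hw k) (hw1 k) η
  have h₁ := h η
  have h₂ := h η₀
  refine Continuous.measurable ?_
  unfold expertLoss
  fun_prop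

theorem measurable_scoreLoss_scoreNet (hγ : 0 < γ) (hw : ∀ k l, 0 ≤ w k l)
    (hw1 : ∀ k, ∑ l, w k l = 1) (hU : ∀ k l, ‖(θstar k l).snd‖ = 1) (θ : Param d n) :
    Measurable fun x => scoreLoss s γ w θstar x (scoreNet s γ w θ x) := by
  simp only [scoreLoss_scoreNet_eq_sum hγ hw hw1 hU]
  exact Finset.measurable_fun_sum _ fun k _ => measurable_expertLoss hγ hw hw1 k _ _

theorem uniformDeviation_le {P : Measure (Data d)} {Θ : Set (Param d n)} {N : ℕ}
    {X : Fin N → Data d} {a : ℝ} (h : ∀ θ ∈ Θ, |empDeviation P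
      (fun x => scoreLoss s γ w θstar x (scoreNet s γ w θ x)) X| ≤ a) :
    uniformDeviation s γ w θstar P Θ X ≤ ENNReal.ofReal a :=
  iSup₂_le fun θ hθ => ENNReal.ofReal_le_ofReal (h θ hθ)

end scoreNet

/-- The bounds of `exists_expertScore_bounds` for the experts of a network. -/
structure ExpertBounds (s γ Bμ BU M ρ : ℝ) {K : ℕ} (d n : Fin K → ℕ) (w : ∀ k, Fin (n k) → ℝ) :
    Prop where
  one_le : 1 ≤ ρ
  pos : 0 < M
  norm_le : ∀ k (x : Latent (d k)), ‖x‖ ≤ ρ → ∀ η : ExpertParam (d k) (n k),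
    (∀ l, ‖(η l).fst‖ ≤ Bμ ∧ ‖(η l).snd‖ ≤ BU) → ‖expertScore s γ (w k) η x‖ ≤ M * ρ
  lipschitz : ∀ k (x : Latent (d k)), ‖x‖ ≤ ρ → ∀ η η' : ExpertParam (d k) (n k),
    (∀ l, ‖(η l).fst‖ ≤ Bμ ∧ ‖(η l).snd‖ ≤ BU) → (∀ l, ‖(η' l).fst‖ ≤ Bμ ∧ ‖(η' l).snd‖ ≤ BU) →
    ∀ h : ℝ, (∀ l, ‖η l - η' l‖ ≤ h) →
    ‖expertScore s γ (w k) η x - expertScore s γ (w k) η' x‖ ≤ M * ρ ^ 3 * h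

namespace ExpertBounds

variable {K : ℕ} {d n : Fin K → ℕ} {s γ Bμ BU M ρ : ℝ} {w : ∀ k, Fin (n k) → ℝ}
  {θstar : Param d n}

theorem expertLoss_le (hb : ExpertBounds s γ Bμ BU M ρ d n w) {k : Fin K} {x : Latent (d k)}
    (hx : ‖x‖ ≤ ρ) {η₀ η : ExpertParam (d k) (n k)}
    (hη₀ : ∀ l, ‖(η₀ l).fst‖ ≤ Bμ ∧ ‖(η₀ l).snd‖ ≤ BU)
    (hη : ∀ l, ‖(η l).fst‖ ≤ Bμ ∧ ‖(η l).snd‖ ≤ BU) :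
    expertLoss s γ (w k) η₀ η x ≤ (2 * M * ρ) ^ 2 := by
  unfold expertLoss
  refine pow_le_pow_left₀ (norm_nonneg _) ((norm_sub_le _ _).trans ?_) 2
  linarith [hb.norm_le k x hx η hη, hb.norm_le k x hx η₀ hη₀]

theorem abs_expertLoss_sub_le (hb : ExpertBounds s γ Bμ BU M ρ d n w) {k : Fin K}
    {x : Latent (d k)} (hx : ‖x‖ ≤ ρ) {η₀ η η' : ExpertParam (d k) (n k)}
    (hη₀ : ∀ l, ‖(η₀ l).fst‖ ≤ Bμ ∧ ‖(η₀ l).snd‖ ≤ BU)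
    (hη : ∀ l, ‖(η l).fst‖ ≤ Bμ ∧ ‖(η l).snd‖ ≤ BU)
    (hη' : ∀ l, ‖(η' l).fst‖ ≤ Bμ ∧ ‖(η' l).snd‖ ≤ BU) {h : ℝ} (hh : ∀ l, ‖η l - η' l‖ ≤ h) :
    |expertLoss s γ (w k) η₀ η x - expertLoss s γ (w k) η₀ η' x| ≤ 4 * M ^ 2 * ρ ^ 4 * h := by
  have h₀ := hb.norm_le k x hx η₀ hη₀
  have h₁ := hb.norm_le k x hx η hη
  have h₂ := hb.norm_le k x hx η' hη'
  have hl := hb.lipschitz k x hx η η' hη hη' h hh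
  unfold expertLoss
  set a := expertScore s γ (w k) η x
  set a' := expertScore s γ (w k) η' x
  set a₀ := expertScore s γ (w k) η₀ x
  have h₃ : ‖a - a₀‖ ≤ 2 * M * ρ := (norm_sub_le _ _).trans (by linarith)
  have h₄ : ‖a' - a₀‖ ≤ 2 * M * ρ := (norm_sub_le _ _).trans (by linarith)
  refine (abs_sq_sub_sq_le (c := 2 * M * ρ) (e := M * ρ ^ 3 * h) (by rwa [abs_norm])
    (by rwa [abs_norm]) ?_).trans_eq (by ring)
  refine (abs_norm_sub_norm_le _ _).trans ?_
  rwa [sub_sub_sub_cancel_right]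

theorem abs_scoreLoss_le (hb : ExpertBounds s γ Bμ BU M ρ d n w) (hγ : 0 < γ)
    (hw : ∀ k l, 0 ≤ w k l) (hw1 : ∀ k, ∑ l, w k l = 1) (hU : ∀ k l, ‖(θstar k l).snd‖ = 1)
    (hstar : ∀ k l, ‖(θstar k l).fst‖ ≤ Bμ ∧ ‖(θstar k l).snd‖ ≤ BU) {θ : Param d n}
    (hθ : ∀ k l, ‖(θ k l).fst‖ ≤ Bμ ∧ ‖(θ k l).snd‖ ≤ BU) {x : Data d} (hx : ∀ k, ‖x k‖ ≤ ρ) :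
    |scoreLoss s γ w θstar x (scoreNet s γ w θ x)| ≤ K * (2 * M * ρ) ^ 2 := by
  rw [abs_of_nonneg (sq_nonneg _), scoreLoss_scoreNet_eq_sum hγ hw hw1 hU]
  refine (Finset.sum_le_sum fun k _ => hb.expertLoss_le (hx k) (hstar k) (hθ k)).trans_eq ?_
  simp

theorem isNetLipschitz (hb : ExpertBounds s γ Bμ BU M ρ d n w) {𝒳 : Set (Data d)}
    (hx : ∀ x ∈ 𝒳, ∀ k, ‖x k‖ ≤ ρ) {Θ : Set (Param d n)}
    (hΘ : ∀ θ ∈ Θ, ∀ k l, ‖(θ k l).fst‖ ≤ Bμ ∧ ‖(θ k l).snd‖ ≤ BU) :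
    IsNetLipschitz s γ w 𝒳 Θ (M * ρ ^ 3).toNNReal := by
  have hM := hb.pos
  have hρ : 0 < ρ := zero_lt_one.trans_le hb.one_le
  intro x hx𝒳
  refine LipschitzOnWith.of_dist_le_mul fun θ hθ θ' hθ' => ?_
  rw [Real.coe_toNNReal _ (by positivity), dist_eq_norm, dist_eq_norm,
    ← sq_le_sq₀ (norm_nonneg _) (by positivity), mul_pow, PiLp.norm_sq_eq_of_L2,
    PiLp.norm_sq_eq_of_L2, Finset.mul_sum]
  refine Finset.sum_le_sum fun k _ => ?_
  rw [← mul_pow]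
  refine pow_le_pow_left₀ (norm_nonneg _) (hb.lipschitz k (x k) (hx x hx𝒳 k) (θ k) (θ' k) (hΘ θ hθ k)
    (hΘ θ' hθ' k) ‖(θ - θ') k‖ fun l => ?_) 2
  exact PiLp.norm_apply_le ((θ - θ') k) l

theorem isLossLipschitz (hb : ExpertBounds s γ Bμ BU M ρ d n w) (hγ : 0 < γ)
    (hw : ∀ k l, 0 ≤ w k l) (hw1 : ∀ k, ∑ l, w k l = 1) (hU : ∀ k l, ‖(θstar k l).snd‖ = 1)
    {𝒳 : Set (Data d)} (hx : ∀ x ∈ 𝒳, ∀ k, ‖x k‖ ≤ ρ) {Θ : Set (Param d n)} (hstar : θstar ∈ Θ)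
    (hΘ : ∀ θ ∈ Θ, ∀ k l, ‖(θ k l).fst‖ ≤ Bμ ∧ ‖(θ k l).snd‖ ≤ BU) :
    IsLossLipschitz s γ w θstar 𝒳 Θ (4 * √K * M * ρ).toNNReal := by
  have hM := hb.pos
  have hρ : 0 < ρ := zero_lt_one.trans_le hb.one_le
  intro x hx𝒳
  have hval : ∀ θ ∈ Θ, ‖scoreNet s γ w θ x - trueScore s γ w θstar x‖ ≤ √K * (2 * M * ρ) := by
    intro θ hθ
    have h := hb.abs_scoreLoss_le hγ hw hw1 hU (hΘ _ hstar) (hΘ θ hθ) (hx x hx𝒳)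
    rw [abs_of_nonneg (sq_nonneg _), scoreLoss] at h
    rw [← sq_le_sq₀ (norm_nonneg _) (by positivity), mul_pow, Real.sq_sqrt (by positivity)]
    exact h
  refine LipschitzOnWith.of_dist_le_mul ?_
  rintro _ ⟨θ, hθ, rfl⟩ _ ⟨θ', hθ', rfl⟩
  rw [Real.coe_toNNReal _ (by positivity), Real.dist_eq, dist_eq_norm]
  refine (abs_sq_sub_sq_le (c := √K * (2 * M * ρ))
    (e := ‖scoreNet s γ w θ x - scoreNet s γ w θ' x‖) (by rw [abs_norm]; exact hval θ hθ)
    (by rw [abs_norm]; exact hval θ' hθ') ?_).trans_eq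
      (by ring)
  refine (abs_norm_sub_norm_le _ _).trans_eq ?_
  rw [sub_sub_sub_cancel_right]

theorem measure_uniformDeviation_of_isLipschitz (hb : ExpertBounds s γ Bμ BU M ρ d n w)
    (hγ : 0 < γ) (hw : ∀ k l, 0 ≤ w k l) (hw1 : ∀ k, ∑ l, w k l = 1)
    (hU : ∀ k l, ‖(θstar k l).snd‖ = 1)
    {𝒳 : Set (Data d)} (hx : ∀ x ∈ 𝒳, ∀ k, ‖x k‖ ≤ ρ) {Θ : Set (Param d n)} (hstar : θstar ∈ Θ)
    (hΘ : ∀ θ ∈ Θ, ∀ k l, ‖(θ k l).fst‖ ≤ Bμ ∧ ‖(θ k l).snd‖ ≤ BU)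
    {P : Measure (Data d)} [IsProbabilityMeasure P] (hP : ∀ᵐ x ∂P, x ∈ 𝒳) {N : ℕ} (hN : 1 ≤ N)
    {δ : ℝ} (hδ : 0 < δ) (hδ1 : δ < 1) {L Lℓ : ℝ≥0} (hL : IsNetLipschitz s γ w 𝒳 Θ L)
    (hLℓ : IsLossLipschitz s γ w θstar 𝒳 Θ Lℓ) :
    ENNReal.ofReal (1 - δ) ≤ Measure.pi (fun _ : Fin N => P)
      {X | uniformDeviation s γ w θstar P Θ X ≤ ENNReal.ofReal
        (28 * Metric.diam Θ * L * Lℓ * √((numParams d n : ℝ) / N) +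
          6 * (K * (2 * M * ρ) ^ 2) * √(Real.log (1 / δ) / N))} := by
  have hN' : (0 : ℝ) < N := by exact_mod_cast hN
  have hsN : 0 < √(N : ℝ) := Real.sqrt_pos.2 hN'
  have hbdd := isBounded_of_norm_le hΘ
  obtain ⟨Q, hQm, hQint, hQ⟩ := exists_chaining_bound (P := P) (N := N) (δ := δ)
    (f := fun θ x => scoreLoss s γ w θstar x (scoreNet s γ w θ x)) (Θ := Θ) (θ₀ := θstar)
    (B := K * (2 * M * ρ) ^ 2) (Λ := L * Lℓ) (r := Metric.diam Θ) hstar (by positivity)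
    (by positivity) (fun θ hθ => Metric.dist_le_diam_of_mem hbdd hθ hstar)
    (fun θ _ => measurable_scoreLoss_scoreNet hγ hw hw1 hU θ)
    (by
      filter_upwards [hP] with x hx𝒳
      refine ⟨fun θ hθ => hb.abs_scoreLoss_le hγ hw hw1 hU (hΘ _ hstar) (hΘ θ hθ) (hx x hx𝒳), ?_, ?_⟩
      · simp [scoreLoss, trueScore_eq_scoreNet hγ hw hw1 hU]
      · intro θ hθ θ' hθ'
        have h₁ := (hLℓ x hx𝒳).dist_le_mul _ ⟨θ, hθ, rfl⟩ _ ⟨θ', hθ', rfl⟩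
        have h₂ := (hL x hx𝒳).dist_le_mul θ hθ θ' hθ'
        rw [Real.dist_eq] at h₁
        refine h₁.trans ((mul_le_mul_of_nonneg_left h₂ Lℓ.coe_nonneg).trans_eq (by ring)))
    hN hδ hδ1
  rw [finrank_param] at hQint hQ
  refine ofReal_one_sub_le_measure_of_lintegral_le hQm hδ (Real.sqrt_nonneg _) hQint ?_
  filter_upwards [hQ] with X hX hQX
  refine uniformDeviation_le fun θ hθ => ?_
  have h₁ := hX (ne_top_of_le_ne_top ENNReal.ofReal_ne_top hQX) θ hθ
  have h₂ := ENNReal.toReal_le_of_le_ofReal (Real.sqrt_nonneg _) hQX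
  have hD : 0 ≤ L * Lℓ * Metric.diam Θ := by positivity
  have h₃ := mul_le_mul_of_nonneg_left h₂ hD
  rw [Real.sqrt_div' _ hN'.le, Real.sqrt_div' _ hN'.le, ← mul_div_assoc, ← mul_div_assoc,
    ← add_div, le_div_iff₀' hsN]
  linarith

theorem exists_block_chaining_bound (hb : ExpertBounds s γ Bμ BU M ρ d n w) (hγ : 0 < γ)
    (hBμ : 0 ≤ Bμ) (hBU : 0 ≤ BU) (hw : ∀ k l, 0 ≤ w k l) (hw1 : ∀ k, ∑ l, w k l = 1)
    {𝒳 : Set (Data d)} (hx : ∀ x ∈ 𝒳, ∀ k, ‖x k‖ ≤ ρ) {Θ : Set (Param d n)} (hstar : θstar ∈ Θ)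
    (hΘ : ∀ θ ∈ Θ, ∀ k l, ‖(θ k l).fst‖ ≤ Bμ ∧ ‖(θ k l).snd‖ ≤ BU)
    {P : Measure (Data d)} [IsProbabilityMeasure P] (hP : ∀ᵐ x ∂P, x ∈ 𝒳) {N : ℕ} (hN : 1 ≤ N)
    {δ : ℝ} (hδ : 0 < δ) (hδ1 : δ < 1) (k : Fin K) :
    ∃ Q : (Fin N → Data d) → ℝ≥0∞, Measurable Q ∧
      ∫⁻ X, Q X ∂(Measure.pi fun _ => P) ≤ ENNReal.ofReal (δ * √(2 * (n k * d k))) ∧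
      ∀ᵐ X ∂(Measure.pi fun _ : Fin N => P), Q X ≠ ∞ → ∀ θ ∈ Θ,
        √N * |empDeviation P (fun x => expertLoss s γ (w k) (θstar k) (θ k) (x k)) X| ≤
          24 * (4 * M ^ 2 * ρ ^ 4 * (2 * (Bμ + BU))) * √(2 * (n k * d k)) +
          6 * (2 * M * ρ) ^ 2 * √(Real.log (1 / δ)) +
          4 * (4 * M ^ 2 * ρ ^ 4 * (2 * (Bμ + BU))) * (Q X).toReal := by
  have hM := hb.pos
  have hρ : 0 < ρ := zero_lt_one.trans_le hb.one_le
  have hrank : (Module.finrank ℝ (Fin (n k) → WithLp 2 (Latent (d k) × Latent (d k))) : ℝ) =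
      2 * (n k * d k) := by
    rw [Module.finrank_pi_fintype]
    simp only [LinearEquiv.finrank_eq (WithLp.linearEquiv 2 ℝ (Latent (d k) × Latent (d k))),
      Module.finrank_prod, finrank_euclideanSpace_fin]
    simp
    ring
  obtain ⟨Q, hQm, hQint, hQ⟩ := exists_chaining_bound (P := P) (N := N) (δ := δ)
    (E := Fin (n k) → WithLp 2 (Latent (d k) × Latent (d k)))
    (f := fun η x => expertLoss s γ (w k) (θstar k) (WithLp.toLp 2 η) (x k))
    (Θ := (fun θ : Param d n => WithLp.ofLp (θ k)) '' Θ) (θ₀ := WithLp.ofLp (θstar k))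
    (B := (2 * M * ρ) ^ 2) (Λ := 4 * M ^ 2 * ρ ^ 4) (r := 2 * (Bμ + BU)) ⟨θstar, hstar, rfl⟩
    (by positivity) (by positivity)
    (by
      rintro _ ⟨θ, hθ, rfl⟩
      refine (dist_pi_le_iff (by positivity)).2 fun l => ?_
      have h₁ := hΘ θ hθ k l
      have h₂ := hΘ θstar hstar k l
      have h₃ := norm_le_norm_fst_add_norm_snd (θ k l)
      have h₄ := norm_le_norm_fst_add_norm_snd (θstar k l)
      have h₅ := dist_le_norm_add_norm (θ k l) (θstar k l)
      linarith)
    (fun η _ => measurable_expertLoss hγ hw hw1 k _ _)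
    (by
      filter_upwards [hP] with x hx𝒳
      have hxk := hx x hx𝒳 k
      refine ⟨?_, ?_, ?_⟩
      · rintro _ ⟨θ, hθ, rfl⟩
        rw [abs_of_nonneg (sq_nonneg _)]
        exact hb.expertLoss_le hxk (hΘ _ hstar k) (hΘ θ hθ k)
      · simp [expertLoss]
      · rintro _ ⟨θ, hθ, rfl⟩ _ ⟨θ', hθ', rfl⟩
        refine hb.abs_expertLoss_sub_le hxk (hΘ _ hstar k) (hΘ θ hθ k) (hΘ θ' hθ' k) fun l => ?_
        rw [← dist_eq_norm]
        exact dist_le_pi_dist (WithLp.ofLp (θ k)) (WithLp.ofLp (θ' k)) l)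
    hN hδ hδ1
  rw [hrank] at hQint hQ
  refine ⟨Q, hQm, hQint, hQ.mono fun X hX hQX θ hθ => ?_⟩
  exact hX hQX _ ⟨θ, hθ, rfl⟩

theorem measure_uniformDeviation (hb : ExpertBounds s γ Bμ BU M ρ d n w)
    (hγ : 0 < γ) (hBμ : 0 ≤ Bμ) (hBU : 0 ≤ BU) (hw : ∀ k l, 0 ≤ w k l)
    (hw1 : ∀ k, ∑ l, w k l = 1) (hU : ∀ k l, ‖(θstar k l).snd‖ = 1)
    {𝒳 : Set (Data d)} (hx : ∀ x ∈ 𝒳, ∀ k, ‖x k‖ ≤ ρ) {Θ : Set (Param d n)} (hstar : θstar ∈ Θ)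
    (hΘ : ∀ θ ∈ Θ, ∀ k l, ‖(θ k l).fst‖ ≤ Bμ ∧ ‖(θ k l).snd‖ ≤ BU)
    {P : Measure (Data d)} [IsProbabilityMeasure P] (hP : ∀ᵐ x ∂P, x ∈ 𝒳) {N : ℕ} (hN : 1 ≤ N)
    {δ : ℝ} (hδ : 0 < δ) (hδ1 : δ < 1) :
    ENNReal.ofReal (1 - δ) ≤ Measure.pi (fun _ : Fin N => P)
      {X | uniformDeviation s γ w θstar P Θ X ≤ ENNReal.ofReal
        (28 * (4 * M ^ 2 * ρ ^ 4 * (2 * (Bμ + BU))) * (∑ k, √(2 * (n k * d k))) / √N +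
          6 * (K * (2 * M * ρ) ^ 2) * √(Real.log (1 / δ) / N))} := by
  have hN' : (0 : ℝ) < N := by exact_mod_cast hN
  have hsN : 0 < √(N : ℝ) := Real.sqrt_pos.2 hN'
  have hρ : 0 < ρ := zero_lt_one.trans_le hb.one_le
  choose Q hQm hQint hQ using hb.exists_block_chaining_bound hγ hBμ hBU hw hw1 hx hstar hΘ hP hN hδ hδ1
  refine ofReal_one_sub_le_measure_of_lintegral_le (Q := fun X => ∑ k, Q k X)
    (a := ∑ k, √(2 * (n k * d k))) (Finset.measurable_fun_sum _ fun k _ => hQm k) hδ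
    (Finset.sum_nonneg fun k _ => Real.sqrt_nonneg _) ?_ ?_
  · rw [lintegral_finsetSum' _ fun k _ => (hQm k).aemeasurable, Finset.mul_sum,
      ENNReal.ofReal_sum_of_nonneg fun k _ => by positivity]
    exact Finset.sum_le_sum fun k _ => hQint k
  filter_upwards [ae_all_iff.2 hQ] with X hX hQX
  refine uniformDeviation_le fun θ hθ => ?_
  have hQtop : ∀ k, Q k X ≠ ∞ := fun k => ne_top_of_le_ne_top ENNReal.ofReal_ne_top
    ((Finset.single_le_sum (f := fun k => Q k X) (fun _ _ => zero_le) (Finset.mem_univ k)).trans hQX)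
  have hQsum : ∑ k, (Q k X).toReal ≤ ∑ k, √(2 * (n k * d k)) := by
    rw [← ENNReal.toReal_sum fun k _ => hQtop k]
    exact ENNReal.toReal_le_of_le_ofReal (Finset.sum_nonneg fun k _ => Real.sqrt_nonneg _) hQX
  have hdecomp : empDeviation P (fun x => scoreLoss s γ w θstar x (scoreNet s γ w θ x)) X =
      ∑ k, empDeviation P (fun x => expertLoss s γ (w k) (θstar k) (θ k) (x k)) X := by
    have hint : ∀ k, Integrable
        (fun x : Data d => expertLoss s γ (w k) (θstar k) (θ k) (x k)) P := fun k => by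
      refine Integrable.of_bound (measurable_expertLoss hγ hw hw1 k _ _).aestronglyMeasurable
        ((2 * M * ρ) ^ 2) (hP.mono fun x hx𝒳 => ?_)
      rw [expertLoss, norm_pow, norm_norm]
      exact hb.expertLoss_le (hx x hx𝒳 k) (hΘ _ hstar k) (hΘ θ hθ k)
    simp only [empDeviation, scoreLoss_scoreNet_eq_sum hγ hw hw1 hU, Finset.sum_sub_distrib,
      ← Finset.mul_sum]
    rw [integral_finsetSum _ fun k _ => hint k, Finset.sum_comm]
  rw [hdecomp]
  have hD : 0 ≤ 4 * M ^ 2 * ρ ^ 4 * (2 * (Bμ + BU)) := by positivity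
  have hsum := Finset.sum_le_sum fun k (_ : k ∈ Finset.univ) => hX k (hQtop k) θ hθ
  simp only [Finset.sum_add_distrib, ← Finset.mul_sum, Finset.sum_const, Finset.card_univ,
    Fintype.card_fin, nsmul_eq_mul] at hsum
  have habs := mul_le_mul_of_nonneg_left (Finset.abs_sum_le_sum_abs
    (fun k => empDeviation P (fun x => expertLoss s γ (w k) (θstar k) (θ k) (x k)) X)
    Finset.univ) hsN.le
  have h₃ := mul_le_mul_of_nonneg_left hQsum hD
  rw [Real.sqrt_div' _ hN'.le, ← mul_div_assoc, ← add_div, le_div_iff₀' hsN]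
  linarith

end ExpertBounds

theorem sum_sqrt_le {K : ℕ} (d n : Fin K → ℕ) (hn : ∀ k, 1 ≤ n k) :
    ∑ k, √(2 * ((n k : ℝ) * d k)) ≤ √2 * (√(∑ k, n k : ℕ) * √(∑ k, n k * d k : ℕ)) := by
  have hK : (K : ℝ) ≤ (∑ k, n k : ℕ) := by
    have h := Finset.sum_le_sum fun k (_ : k ∈ Finset.univ) => hn k
    simp only [Finset.sum_const, Finset.card_univ, Fintype.card_fin, smul_eq_mul, mul_one] at h
    exact_mod_cast h
  have hcs := sq_sum_le_card_mul_sum_sq (s := Finset.univ)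
    (f := fun k => √(2 * ((n k : ℝ) * d k)))
  rw [← Real.sqrt_mul (by positivity), ← Real.sqrt_mul (by positivity)]
  refine Real.le_sqrt_of_sq_le (hcs.trans ?_)
  have e : ∑ k, √(2 * ((n k : ℝ) * d k)) ^ 2 = 2 * (∑ k, n k * d k : ℕ) := by
    push_cast
    rw [Finset.mul_sum]
    exact Finset.sum_congr rfl fun k _ => Real.sq_sqrt (by positivity)
  rw [e, Finset.card_univ, Fintype.card_fin, mul_left_comm]
  gcongr

end MoLRMoG

theorem mainTheorem1 :
    ∃ c : ℝ, 0 < c ∧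
    ∀ s γ Bμ BU : ℝ, 0 < s → 0 < γ → 0 ≤ Bμ → 0 ≤ BU →
    ∃ C : ℝ, 0 < C ∧
    ∀ (K : ℕ) (R : ℝ), 0 < R →
    ∃ C₂ : ℝ, 0 < C₂ ∧
    ∀ (d n : Fin K → ℕ) (w : ∀ k, Fin (n k) → ℝ),
      (∀ k l, 0 ≤ w k l) → (∀ k, ∑ l, w k l = 1) →
    ∀ (𝒳 : Set (MoLRMoG.Data d)), (∀ x ∈ 𝒳, ∀ k, ‖x k‖ ≤ R) →
    ∀ (Θ : Set (MoLRMoG.Param d n)),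
      (∀ θ ∈ Θ, ∀ k l, ‖(θ k l).fst‖ ≤ Bμ ∧ ‖(θ k l).snd‖ ≤ BU) →
    ∀ θstar ∈ Θ, (∀ k l, ‖(θstar k l).snd‖ = 1) →
    ∀ (P : MeasureTheory.Measure (MoLRMoG.Data d)) [MeasureTheory.IsProbabilityMeasure P],
      (∀ᵐ x ∂P, x ∈ 𝒳) →
    (∀ θ ∈ Θ, MeasureTheory.Integrable
      (fun x => MoLRMoG.scoreLoss s γ w θstar x (MoLRMoG.scoreNet s γ w θ x)) P) ∧
    (∃ L Lℓ : NNReal,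
      MoLRMoG.IsNetLipschitz s γ w 𝒳 Θ L ∧ MoLRMoG.IsLossLipschitz s γ w θstar 𝒳 Θ Lℓ ∧
      (1 ≤ R → (L : ℝ) * Lℓ ≤ C * R ^ 4 * √(∑ k, n k : ℕ))) ∧
    ∀ (N : ℕ), 1 ≤ N → ∀ δ : ℝ, 0 < δ → δ < 1 →
      (∀ L Lℓ : NNReal,
        MoLRMoG.IsNetLipschitz s γ w 𝒳 Θ L → MoLRMoG.IsLossLipschitz s γ w θstar 𝒳 Θ Lℓ →
        ENNReal.ofReal (1 - δ) ≤ MeasureTheory.Measure.pi (fun _ : Fin N => P)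
          {X | MoLRMoG.uniformDeviation s γ w θstar P Θ X ≤ ENNReal.ofReal
            (c * Metric.diam Θ * L * Lℓ * √((MoLRMoG.numParams d n : ℝ) / N)
              + C₂ * √(Real.log (1 / δ) / N))}) ∧
      (1 ≤ R →
        ENNReal.ofReal (1 - δ) ≤ MeasureTheory.Measure.pi (fun _ : Fin N => P)
          {X | MoLRMoG.uniformDeviation s γ w θstar P Θ X ≤ ENNReal.ofReal
            (C * R ^ 4 * √(∑ k, n k : ℕ) * √(∑ k, n k * d k : ℕ) / √N
              + C₂ * √(Real.log (1 / δ) / N))}) := by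
  refine ⟨28, by norm_num, fun s γ Bμ BU hs hγ hBμ hBU => ?_⟩
  obtain ⟨M, hM, hbound⟩ := MoLRMoG.exists_expertScore_bounds hs hγ hBμ hBU
  refine ⟨64 * M ^ 2 * (1 + 56 * (Bμ + BU) * √2), by positivity, fun K R hR => ?_⟩
  refine ⟨6 * (K * (2 * M * (1 + R)) ^ 2) + 1, by positivity, ?_⟩
  intro d n w hw hw1 𝒳 h𝒳 Θ hΘ θstar hstar hU P _ hP
  have hx : ∀ x ∈ 𝒳, ∀ k, ‖x k‖ ≤ 1 + R := fun x hx k => (h𝒳 x hx k).trans (by linarith)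
  have hb : MoLRMoG.ExpertBounds s γ Bμ BU M (1 + R) d n w := by
    refine ⟨by linarith, hM, fun k x hx η hη => (hbound (hw k) (hw1 k) (by linarith) hx hη).1,
      fun k x hx η η' hη hη' h hh => (hbound (hw k) (hw1 k) (by linarith) hx hη).2 hη' fun l => ?_⟩
    exact ⟨(MoLRMoG.norm_fst_le_norm (η l - η' l)).trans (hh l),
      (MoLRMoG.norm_snd_le_norm (η l - η' l)).trans (hh l)⟩
  have hn : ∀ k, 1 ≤ n k := fun k => by
    by_contra h
    have h0 : n k = 0 := by omega
    have := hw1 k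
    have hempty : IsEmpty (Fin (n k)) := by rw [h0]; infer_instance
    simp at this
  have hR4 : 1 ≤ R → (1 + R) ^ 4 ≤ 16 * R ^ 4 := fun h1 => by
    calc (1 + R) ^ 4 ≤ (2 * R) ^ 4 := pow_le_pow_left₀ (by linarith) (by linarith) 4
      _ = 16 * R ^ 4 := by ring
  refine ⟨fun θ hθ => ?_, ⟨_, _, hb.isNetLipschitz hx hΘ,
    hb.isLossLipschitz hγ hw hw1 hU hx hstar hΘ, fun h1 => ?_⟩, fun N hN δ hδ hδ1 => ⟨?_, ?_⟩⟩
  · exact Integrable.of_bound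
      (MoLRMoG.measurable_scoreLoss_scoreNet hγ hw hw1 hU θ).aestronglyMeasurable _
      (hP.mono fun x hx𝒳 =>
        hb.abs_scoreLoss_le hγ hw hw1 hU (hΘ _ hstar) (hΘ θ hθ) (hx x hx𝒳))
  · rw [Real.coe_toNNReal _ (by positivity), Real.coe_toNNReal _ (by positivity)]
    have hK : √(K : ℝ) ≤ √(∑ k, n k : ℕ) := by
      refine Real.sqrt_le_sqrt ?_
      have h := Finset.sum_le_sum fun k (_ : k ∈ Finset.univ) => hn k
      simp only [Finset.sum_const, Finset.card_univ, Fintype.card_fin, smul_eq_mul, mul_one] at h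
      exact_mod_cast h
    calc M * (1 + R) ^ 3 * (4 * √K * M * (1 + R)) = 4 * M ^ 2 * (1 + R) ^ 4 * √K := by ring
      _ ≤ 4 * M ^ 2 * (16 * R ^ 4) * √(∑ k, n k : ℕ) := by
          gcongr
          exact hR4 h1
      _ = 64 * M ^ 2 * 1 * R ^ 4 * √(∑ k, n k : ℕ) := by ring
      _ ≤ _ := by
          gcongr
          have : 0 ≤ 56 * (Bμ + BU) * √2 := by positivity
          linarith
  · intro L Lℓ hL hLℓ
    refine (hb.measure_uniformDeviation_of_isLipschitz hγ hw hw1 hU hx hstar hΘ hP hN hδ hδ1 hL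
      hLℓ).trans (measure_mono fun X hX => le_trans hX (ENNReal.ofReal_le_ofReal ?_))
    gcongr
    linarith
  · intro h1
    refine (hb.measure_uniformDeviation hγ hBμ hBU hw hw1 hU hx hstar hΘ hP hN hδ hδ1).trans
      (measure_mono fun X hX => le_trans hX (ENNReal.ofReal_le_ofReal (add_le_add ?_ ?_)))
    · refine div_le_div_of_nonneg_right ?_ (Real.sqrt_nonneg _)
      calc _ ≤ 28 * (4 * M ^ 2 * (16 * R ^ 4) * (2 * (Bμ + BU))) *
            (√2 * (√(∑ k, n k : ℕ) * √(∑ k, n k * d k : ℕ))) := by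
            gcongr
            · exact hR4 h1
            · exact MoLRMoG.sum_sqrt_le d n hn
        _ = 64 * M ^ 2 * (56 * (Bμ + BU) * √2) * R ^ 4 * √(∑ k, n k : ℕ) *
            √(∑ k, n k * d k : ℕ) := by ring
        _ ≤ _ := by
            gcongr
            linarith
    · gcongr
      linarith
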